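/- **Notation.** For functions $u^-,u^+,v,w$ of one complex variable and functions $R,T$ of $(x,y)$, put $$P=-\tfrac12(\partial_x^2+\partial_y^2)+R(x,y),$$ $$P_2=\bigl(\partial_x\partial_y+u^-(x-y)-u^+(x+y)\bigr)^2-2w(y)\partial_x^2-2v(x)\partial_y^2+4v(x)w(y)+T(x,y).$$ These are regarded as differential operators on the set $\Omega\subset\mathbb C^2$ given for each family below, acting on functions holomorphic on open subsets of $\Omega$. We write $\sinh^{-2}t=1/(\sinh t)^2$ and $\cosh^{-2}t=1/(\cosh t)^2$. Let $\wp(t)=\wp(t;2\omega_1,2\omega_2)$ be the Weierstrass function with period lattice $\Lambda=2\mathbb Z\omega_1+2\mathbb Z\omega_2$, where $\omega_1,\omega_2\in\mathbb C$ are linearly independent over $\mathbb R$, and put $\omega_0=0$, $\omega_3=-\omega_1-\omega_2$. **Theorem ($B_2$: normal case).** Let $\lambda,A,C_0,C_1,C_2,C_3\in\mathbb C$. (For $\lambda=0$ the set $\Omega$ is empty in the families in which $\sinh^{-2}$ occurs.) For each of the families listed below, $$R(x,y)=u^+(x+y)+u^-(x-y)+v(x)+w(y)\quad\text{on }\Omega,$$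 $P_2=\partial_x^2\partial_y^2+S$ with a differential operator $S$ of order less than $4$ with holomorphic coefficients on $\Omega$, and $$[P,P_2]=0 .$$ 1. (Ellip-$B_2$) $\Omega$: $x\pm y\notin\Lambda$ and $x+\omega_j,\,y+\omega_j\notin\Lambda$ for $j=0,1,2,3$. $u^\pm(t)=A\wp(t)$, $\;v(t)=w(t)=\sum_{j=0}^3C_j\wp(t+\omega_j)$, $R=A(\wp(x-y)+\wp(x+y))+\sum_{j=0}^3C_j(\wp(x+\omega_j)+\wp(y+\omega_j))$, $T=2A(\wp(x-y)+\wp(x+y))\sum_{j=0}^3C_j(\wp(x+\omega_j)+\wp(y+\omega_j))-4A\sum_{j=0}^3C_j\wp(x+\omega_j)\wp(y+\omega_j)$. 2. (Trig-$B_2$) $\Omega$: $\sinh\lambda(x\pm y)$, $\sinh\lambda x$, $\cosh\lambda x$, $\sinh\lambda y$, $\cosh\lambda y$ all nonzero. $u^\pm(t)=A\sinh^{-2}\lambda t$, $\;v(t)=w(t)=C_0\sinh^{-2}\lambda t+C_1\cosh^{-2}\lambda t+C_2\sinh^2\lambda t+\frac14C_3\sinh^22\lambda t$, $R=A(\sinh^{-2}\lambda(x-y)+\sinh^{-2}\lambda(x+y))+C_0(\sinh^{-2}\lambda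 x+\sinh^{-2}\lambda y)+C_1(\cosh^{-2}\lambda x+\cosh^{-2}\lambda y)+C_2(\sinh^2\lambda x+\sinh^2\lambda y)+\frac14C_3(\sinh^22\lambda x+\sinh^22\lambda y)$, $T=2A(\sinh^{-2}\lambda(x-y)+\sinh^{-2}\lambda(x+y))\bigl(C_0(\sinh^{-2}\lambda x+\sinh^{-2}\lambda y)+C_1(\cosh^{-2}\lambda x+\cosh^{-2}\lambda y)+C_2(\sinh^2\lambda x+\sinh^2\lambda y)+\frac14C_3(\sinh^22\lambda x+\sinh^22\lambda y)\bigr)-4A\bigl(C_0\sinh^{-2}\lambda x\,\sinh^{-2}\lambda y-C_1\cosh^{-2}\lambda x\,\cosh^{-2}\lambda y+C_3(\sinh^2\lambda x+\sinh^2\lambda y+2\sinh^2\lambda x\,\sinh^2\lambda y)\bigr)$. 3. (Rat-$B_2$) $\Omega$: $x\ne0$, $y\ne0$, $x\ne\pm y$. $u^\pm(t)=At^{-2}$, $\;v(t)=w(t)=C_0t^{-2}+C_1t^2+C_2t^4+C_3t^6$, $R=\frac A{(x-y)^2}+\frac A{(x+y)^2}+C_0(x^{-2}+y^{-2})+C_1(x^2+y^2)+C_2(x^4+y^4)+C_3(x^6+y^6)$,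 and $T$ is either of the two functions $T_1=2(u^-(x-y)+u^+(x+y))(v(x)+w(y))-4A\bigl(\frac{C_0}{x^2y^2}+C_2(x^2+y^2)+C_3(x^4+y^4+3x^2y^2)\bigr)$, $T_2=8A\,\frac{2C_0+2C_1x^2y^2+C_2x^2y^2(x^2+y^2)+2C_3x^4y^4}{(x^2-y^2)^2}$; moreover $T_1=T_2+4AC_1$ on $\Omega$. 4. (Toda-$D_2^{(1)}$-bry) $\Omega$: $\sinh2\lambda x\ne0$, $\sinh2\lambda y\ne0$. $u^\pm(t)=A\cosh2\lambda t$, $\;v(x)=C_0\sinh^{-2}\lambda x+C_1\sinh^{-2}2\lambda x$, $\;w(y)=C_2\sinh^{-2}\lambda y+C_3\sinh^{-2}2\lambda y$, $R=A\cosh2\lambda(x-y)+A\cosh2\lambda(x+y)+C_0\sinh^{-2}\lambda x+C_1\sinh^{-2}2\lambda x+C_2\sinh^{-2}\lambda y+C_3\sinh^{-2}2\lambda y$, $T=8A(C_0\cosh2\lambda y+C_2\cosh2\lambda x)$. 5. (Toda-$B_2^{(1)}$-bry) $\Omega$: $\sinh2\lambda y\ne0$. $u^\pm(t)=Ae^{-2\lambda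 t}$, $\;v(x)=C_0e^{2\lambda x}+C_1e^{4\lambda x}$, $\;w(y)=C_2\sinh^{-2}\lambda y+C_3\sinh^{-2}2\lambda y$, $R=Ae^{-2\lambda(x-y)}+Ae^{-2\lambda(x+y)}+C_0e^{2\lambda x}+C_1e^{4\lambda x}+C_2\sinh^{-2}\lambda y+C_3\sinh^{-2}2\lambda y$, $T=4A(C_0\cosh2\lambda y+2C_2e^{-2\lambda x})$. 6. (Trig-$A_1^{(1)}$-bry) $\Omega$: $\sinh\lambda(x-y)\ne0$. $u^-(t)=A\sinh^{-2}\lambda t$, $\;u^+=0$, $\;v(t)=w(t)=C_0e^{-2\lambda t}+C_1e^{-4\lambda t}+C_2e^{2\lambda t}+C_3e^{4\lambda t}$, $R=A\sinh^{-2}\lambda(x-y)+C_0(e^{-2\lambda x}+e^{-2\lambda y})+C_1(e^{-4\lambda x}+e^{-4\lambda y})+C_2(e^{2\lambda x}+e^{2\lambda y})+C_3(e^{4\lambda x}+e^{4\lambda y})$, $T=2A\sinh^{-2}\lambda(x-y)\bigl(C_0(e^{-2\lambda x}+e^{-2\lambda y})+2C_1e^{-2\lambda(x+y)}+C_2(e^{2\lambda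 x}+e^{2\lambda y})+2C_3e^{2\lambda(x+y)}\bigr)$. 7. (Toda-$C_2^{(1)}$) $\Omega=\mathbb C^2$. $u^-(t)=Ae^{-2\lambda t}$, $\;u^+=0$, $\;v(x)=C_0e^{2\lambda x}+C_1e^{4\lambda x}$, $\;w(y)=C_2e^{-2\lambda y}+C_3e^{-4\lambda y}$, $R=Ae^{-2\lambda(x-y)}+C_0e^{2\lambda x}+C_1e^{4\lambda x}+C_2e^{-2\lambda y}+C_3e^{-4\lambda y}$, $T=2A(C_0e^{2\lambda y}+C_2e^{-2\lambda x})$. 8. (Rat-$A_1$-bry) $\Omega$: $x\ne y$. $u^-(t)=At^{-2}$, $\;u^+=0$, $\;v(t)=w(t)=C_0t+C_1t^2+C_2t^3+C_3t^4$, $R=\frac A{(x-y)^2}+C_0(x+y)+C_1(x^2+y^2)+C_2(x^3+y^3)+C_3(x^4+y^4)$, $T=\frac{2A}{(x-y)^2}\bigl(C_0(x+y)+C_1(x^2+y^2)+C_2xy(x+y)+2C_3x^2y^2\bigr)$. -/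

import Mathlib

/-- `∂/∂x` on functions of two complex variables `(x, y)`. -/
noncomputable def partialX (f : ℂ × ℂ → ℂ) : ℂ × ℂ → ℂ :=
  fun p => deriv (fun s => f (s, p.2)) p.1

/-- `∂/∂y` on functions of two complex variables `(x, y)`. -/
noncomputable def partialY (f : ℂ × ℂ → ℂ) : ℂ × ℂ → ℂ :=
  fun p => deriv (fun t => f (p.1, t)) p.2

/-- The Schrödinger operator `P = -(1/2)(∂x² + ∂y²) + R(x, y)`. -/
noncomputable def schrodingerOp (R : ℂ → ℂ → ℂ) (f : ℂ × ℂ → ℂ) : ℂ × ℂ → ℂ :=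
  fun p => -(1 / 2) * (partialX (partialX f) p + partialY (partialY f) p) + R p.1 p.2 * f p

/-- The operator `∂x ∂y + u⁻(x - y) - u⁺(x + y)`. -/
noncomputable def mixedOp (um up : ℂ → ℂ) (f : ℂ × ℂ → ℂ) : ℂ × ℂ → ℂ :=
  fun p => partialX (partialY f) p + (um (p.1 - p.2) - up (p.1 + p.2)) * f p

/-- The operator `P₂ = (∂x ∂y + u⁻(x - y) - u⁺(x + y))² - 2 w(y) ∂x² - 2 v(x) ∂y²
+ 4 v(x) w(y) + T(x, y)`. -/
noncomputable def fourthOrderOp (um up v w : ℂ → ℂ) (T : ℂ → ℂ → ℂ) (f : ℂ × ℂ → ℂ) :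
    ℂ × ℂ → ℂ :=
  fun p => mixedOp um up (mixedOp um up f) p
    - 2 * w p.2 * partialX (partialX f) p - 2 * v p.1 * partialY (partialY f) p
    + 4 * v p.1 * w p.2 * f p + T p.1 p.2 * f p

/-- `A B = B A` as differential operators on `D`, i.e. on all functions that are holomorphic on
an open subset of `D`. -/
def CommuteOn (D : Set (ℂ × ℂ)) (A B : (ℂ × ℂ → ℂ) → ℂ × ℂ → ℂ) : Prop :=
  ∀ U : Set (ℂ × ℂ), IsOpen U → U ⊆ D → ∀ f : ℂ × ℂ → ℂ, AnalyticOnNhd ℂ f U →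
    ∀ p ∈ U, A (B f) p = B (A f) p

/-- `B = ∂x² ∂y² + S` on `D`, where `S` is a differential operator of order less than four
with holomorphic coefficients on `D`. -/
def HasLeadingPart (D : Set (ℂ × ℂ)) (B : (ℂ × ℂ → ℂ) → ℂ × ℂ → ℂ) : Prop :=
  ∃ a : ℕ → ℕ → ℂ × ℂ → ℂ, (∀ i j, AnalyticOnNhd ℂ (a i j) D) ∧
    ∀ U : Set (ℂ × ℂ), IsOpen U → U ⊆ D → ∀ f : ℂ × ℂ → ℂ, AnalyticOnNhd ℂ f U →
      ∀ p ∈ U, B f p = partialX^[2] (partialY^[2] f) p +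
        ∑ i ∈ Finset.range 4, ∑ j ∈ Finset.range (4 - i),
          a i j p * partialX^[i] (partialY^[j] f) p

/-- The data of a pair of operators of type `B₂`: functions `u⁻, u⁺, v, w` of one variable, the
pair `(R, T)` of functions of `(x, y)`, and the complement `domain` of their singularities. -/
structure B2System where
  domain : Set (ℂ × ℂ)
  um : ℂ → ℂ
  up : ℂ → ℂ
  v : ℂ → ℂ
  w : ℂ → ℂ
  R : ℂ → ℂ → ℂ
  T : ℂ → ℂ → ℂ

/-- `R(x, y) = u⁺(x + y) + u⁻(x - y) + v(x) + w(y)`, the operator `P₂` built from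
`u⁻, u⁺, v, w, T` is of the form `∂x² ∂y² + S` with `ord S < 4`, and it commutes with the
Schrödinger operator `P` with potential `R`. -/
structure B2System.IsCommuting (s : B2System) : Prop where
  potential_eq : ∀ p ∈ s.domain,
    s.R p.1 p.2 = s.up (p.1 + p.2) + s.um (p.1 - p.2) + s.v p.1 + s.w p.2
  leading : HasLeadingPart s.domain (fourthOrderOp s.um s.up s.v s.w s.T)
  commute : CommuteOn s.domain (schrodingerOp s.R) (fourthOrderOp s.um s.up s.v s.w s.T)

/-- `sinh⁻² t = 1 / (sinh t)²`. -/
noncomputable def sinhNegSq (t : ℂ) : ℂ := 1 / Complex.sinh t ^ 2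

/-- `cosh⁻² t = 1 / (cosh t)²`. -/
noncomputable def coshNegSq (t : ℂ) : ℂ := 1 / Complex.cosh t ^ 2

/-- The half periods `ω₀ = 0, ω₁, ω₂, ω₃ = -ω₁ - ω₂` of a period pair. The fields of a
`PeriodPair` are the full periods `2ω₁` and `2ω₂`. -/
noncomputable def halfPeriod (L : PeriodPair) : Fin 4 → ℂ :=
  ![0, L.ω₁ / 2, L.ω₂ / 2, -(L.ω₁ / 2) - L.ω₂ / 2]

/-- Ellip-`B₂`. -/
noncomputable def ellipB2 (L : PeriodPair) (A : ℂ) (C : Fin 4 → ℂ) : B2System where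
  domain := {p | p.1 - p.2 ∉ L.lattice ∧ p.1 + p.2 ∉ L.lattice ∧
    ∀ j, p.1 + halfPeriod L j ∉ L.lattice ∧ p.2 + halfPeriod L j ∉ L.lattice}
  um := fun t => A * L.weierstrassP t
  up := fun t => A * L.weierstrassP t
  v := fun x => ∑ j, C j * L.weierstrassP (x + halfPeriod L j)
  w := fun y => ∑ j, C j * L.weierstrassP (y + halfPeriod L j)
  R := fun x y => A * (L.weierstrassP (x - y) + L.weierstrassP (x + y)) +
    ∑ j, C j * (L.weierstrassP (x + halfPeriod L j) + L.weierstrassP (y + halfPeriod L j))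
  T := fun x y => 2 * A * (L.weierstrassP (x - y) + L.weierstrassP (x + y)) *
      (∑ j, C j *
        (L.weierstrassP (x + halfPeriod L j) + L.weierstrassP (y + halfPeriod L j))) -
    4 * A * ∑ j, C j * L.weierstrassP (x + halfPeriod L j) *
      L.weierstrassP (y + halfPeriod L j)

/-- Trig-`B₂`. -/
noncomputable def trigB2 (lam A : ℂ) (C : Fin 4 → ℂ) : B2System where
  domain := {p | Complex.sinh (lam * (p.1 - p.2)) ≠ 0 ∧ Complex.sinh (lam * (p.1 + p.2)) ≠ 0 ∧
    Complex.sinh (lam * p.1) ≠ 0 ∧ Complex.cosh (lam * p.1) ≠ 0 ∧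
    Complex.sinh (lam * p.2) ≠ 0 ∧ Complex.cosh (lam * p.2) ≠ 0}
  um := fun t => A * sinhNegSq (lam * t)
  up := fun t => A * sinhNegSq (lam * t)
  v := fun x => C 0 * sinhNegSq (lam * x) + C 1 * coshNegSq (lam * x) +
    C 2 * Complex.sinh (lam * x) ^ 2 + 1 / 4 * C 3 * Complex.sinh (2 * lam * x) ^ 2
  w := fun y => C 0 * sinhNegSq (lam * y) + C 1 * coshNegSq (lam * y) +
    C 2 * Complex.sinh (lam * y) ^ 2 + 1 / 4 * C 3 * Complex.sinh (2 * lam * y) ^ 2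
  R := fun x y => A * (sinhNegSq (lam * (x - y)) + sinhNegSq (lam * (x + y))) +
    C 0 * (sinhNegSq (lam * x) + sinhNegSq (lam * y)) +
    C 1 * (coshNegSq (lam * x) + coshNegSq (lam * y)) +
    C 2 * (Complex.sinh (lam * x) ^ 2 + Complex.sinh (lam * y) ^ 2) +
    1 / 4 * C 3 * (Complex.sinh (2 * lam * x) ^ 2 + Complex.sinh (2 * lam * y) ^ 2)
  T := fun x y => 2 * A * (sinhNegSq (lam * (x - y)) + sinhNegSq (lam * (x + y))) *
      (C 0 * (sinhNegSq (lam * x) + sinhNegSq (lam * y)) +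
        C 1 * (coshNegSq (lam * x) + coshNegSq (lam * y)) +
        C 2 * (Complex.sinh (lam * x) ^ 2 + Complex.sinh (lam * y) ^ 2) +
        1 / 4 * C 3 * (Complex.sinh (2 * lam * x) ^ 2 + Complex.sinh (2 * lam * y) ^ 2)) -
    4 * A * (C 0 * sinhNegSq (lam * x) * sinhNegSq (lam * y) -
      C 1 * coshNegSq (lam * x) * coshNegSq (lam * y) +
      C 3 * (Complex.sinh (lam * x) ^ 2 + Complex.sinh (lam * y) ^ 2 +
        2 * Complex.sinh (lam * x) ^ 2 * Complex.sinh (lam * y) ^ 2))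

/-- Rat-`B₂`, with `T` in its first form. -/
noncomputable def ratB2 (A : ℂ) (C : Fin 4 → ℂ) : B2System where
  domain := {p | p.1 ≠ 0 ∧ p.2 ≠ 0 ∧ p.1 - p.2 ≠ 0 ∧ p.1 + p.2 ≠ 0}
  um := fun t => A / t ^ 2
  up := fun t => A / t ^ 2
  v := fun x => C 0 / x ^ 2 + C 1 * x ^ 2 + C 2 * x ^ 4 + C 3 * x ^ 6
  w := fun y => C 0 / y ^ 2 + C 1 * y ^ 2 + C 2 * y ^ 4 + C 3 * y ^ 6
  R := fun x y => A / (x - y) ^ 2 + A / (x + y) ^ 2 + C 0 * (1 / x ^ 2 + 1 / y ^ 2) +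
    C 1 * (x ^ 2 + y ^ 2) + C 2 * (x ^ 4 + y ^ 4) + C 3 * (x ^ 6 + y ^ 6)
  T := fun x y => 2 * (A / (x - y) ^ 2 + A / (x + y) ^ 2) *
      ((C 0 / x ^ 2 + C 1 * x ^ 2 + C 2 * x ^ 4 + C 3 * x ^ 6) +
        (C 0 / y ^ 2 + C 1 * y ^ 2 + C 2 * y ^ 4 + C 3 * y ^ 6)) -
    4 * A * (C 0 / (x ^ 2 * y ^ 2) + C 2 * (x ^ 2 + y ^ 2) +
      C 3 * (x ^ 4 + y ^ 4 + 3 * x ^ 2 * y ^ 2))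

/-- Rat-`B₂`, with `T` in its second form. -/
noncomputable def ratB2Alt (A : ℂ) (C : Fin 4 → ℂ) : B2System :=
  { ratB2 A C with
    T := fun x y => 8 * A * ((2 * C 0 + 2 * C 1 * x ^ 2 * y ^ 2 +
        C 2 * x ^ 2 * y ^ 2 * (x ^ 2 + y ^ 2) + 2 * C 3 * x ^ 4 * y ^ 4) /
      (x ^ 2 - y ^ 2) ^ 2) }

/-- Toda-`D₂⁽¹⁾`-bry. -/
noncomputable def todaD2Bry (lam A : ℂ) (C : Fin 4 → ℂ) : B2System where
  domain := {p | Complex.sinh (2 * lam * p.1) ≠ 0 ∧ Complex.sinh (2 * lam * p.2) ≠ 0}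
  um := fun t => A * Complex.cosh (2 * lam * t)
  up := fun t => A * Complex.cosh (2 * lam * t)
  v := fun x => C 0 * sinhNegSq (lam * x) + C 1 * sinhNegSq (2 * lam * x)
  w := fun y => C 2 * sinhNegSq (lam * y) + C 3 * sinhNegSq (2 * lam * y)
  R := fun x y => A * Complex.cosh (2 * lam * (x - y)) + A * Complex.cosh (2 * lam * (x + y)) +
    C 0 * sinhNegSq (lam * x) + C 1 * sinhNegSq (2 * lam * x) +
    C 2 * sinhNegSq (lam * y) + C 3 * sinhNegSq (2 * lam * y)
  T := fun x y => 8 * A * (C 0 * Complex.cosh (2 * lam * y) + C 2 * Complex.cosh (2 * lam * x))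

/-- Toda-`B₂⁽¹⁾`-bry. -/
noncomputable def todaB2Bry (lam A : ℂ) (C : Fin 4 → ℂ) : B2System where
  domain := {p | Complex.sinh (2 * lam * p.2) ≠ 0}
  um := fun t => A * Complex.exp (-2 * lam * t)
  up := fun t => A * Complex.exp (-2 * lam * t)
  v := fun x => C 0 * Complex.exp (2 * lam * x) + C 1 * Complex.exp (4 * lam * x)
  w := fun y => C 2 * sinhNegSq (lam * y) + C 3 * sinhNegSq (2 * lam * y)
  R := fun x y => A * Complex.exp (-2 * lam * (x - y)) + A * Complex.exp (-2 * lam * (x + y)) +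
    C 0 * Complex.exp (2 * lam * x) + C 1 * Complex.exp (4 * lam * x) +
    C 2 * sinhNegSq (lam * y) + C 3 * sinhNegSq (2 * lam * y)
  T := fun x y => 4 * A *
    (C 0 * Complex.cosh (2 * lam * y) + 2 * C 2 * Complex.exp (-2 * lam * x))

/-- Trig-`A₁⁽¹⁾`-bry. -/
noncomputable def trigA1Bry (lam A : ℂ) (C : Fin 4 → ℂ) : B2System where
  domain := {p | Complex.sinh (lam * (p.1 - p.2)) ≠ 0}
  um := fun t => A * sinhNegSq (lam * t)
  up := fun _ => 0
  v := fun x => C 0 * Complex.exp (-2 * lam * x) + C 1 * Complex.exp (-4 * lam * x) +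
    C 2 * Complex.exp (2 * lam * x) + C 3 * Complex.exp (4 * lam * x)
  w := fun y => C 0 * Complex.exp (-2 * lam * y) + C 1 * Complex.exp (-4 * lam * y) +
    C 2 * Complex.exp (2 * lam * y) + C 3 * Complex.exp (4 * lam * y)
  R := fun x y => A * sinhNegSq (lam * (x - y)) +
    C 0 * (Complex.exp (-2 * lam * x) + Complex.exp (-2 * lam * y)) +
    C 1 * (Complex.exp (-4 * lam * x) + Complex.exp (-4 * lam * y)) +
    C 2 * (Complex.exp (2 * lam * x) + Complex.exp (2 * lam * y)) +
    C 3 * (Complex.exp (4 * lam * x) + Complex.exp (4 * lam * y))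
  T := fun x y => 2 * A * sinhNegSq (lam * (x - y)) *
    (C 0 * (Complex.exp (-2 * lam * x) + Complex.exp (-2 * lam * y)) +
      2 * C 1 * Complex.exp (-2 * lam * (x + y)) +
      C 2 * (Complex.exp (2 * lam * x) + Complex.exp (2 * lam * y)) +
      2 * C 3 * Complex.exp (2 * lam * (x + y)))

/-- Toda-`C₂⁽¹⁾`. -/
noncomputable def todaC2 (lam A : ℂ) (C : Fin 4 → ℂ) : B2System where
  domain := Set.univ
  um := fun t => A * Complex.exp (-2 * lam * t)
  up := fun _ => 0
  v := fun x => C 0 * Complex.exp (2 * lam * x) + C 1 * Complex.exp (4 * lam * x)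
  w := fun y => C 2 * Complex.exp (-2 * lam * y) + C 3 * Complex.exp (-4 * lam * y)
  R := fun x y => A * Complex.exp (-2 * lam * (x - y)) +
    C 0 * Complex.exp (2 * lam * x) + C 1 * Complex.exp (4 * lam * x) +
    C 2 * Complex.exp (-2 * lam * y) + C 3 * Complex.exp (-4 * lam * y)
  T := fun x y => 2 * A *
    (C 0 * Complex.exp (2 * lam * y) + C 2 * Complex.exp (-2 * lam * x))

/-- Rat-`A₁`-bry. -/
noncomputable def ratA1Bry (A : ℂ) (C : Fin 4 → ℂ) : B2System where
  domain := {p | p.1 - p.2 ≠ 0}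
  um := fun t => A / t ^ 2
  up := fun _ => 0
  v := fun x => C 0 * x + C 1 * x ^ 2 + C 2 * x ^ 3 + C 3 * x ^ 4
  w := fun y => C 0 * y + C 1 * y ^ 2 + C 2 * y ^ 3 + C 3 * y ^ 4
  R := fun x y => A / (x - y) ^ 2 + C 0 * (x + y) + C 1 * (x ^ 2 + y ^ 2) +
    C 2 * (x ^ 3 + y ^ 3) + C 3 * (x ^ 4 + y ^ 4)
  T := fun x y => 2 * A / (x - y) ^ 2 *
    (C 0 * (x + y) + C 1 * (x ^ 2 + y ^ 2) + C 2 * x * y * (x + y) +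
      2 * C 3 * x ^ 2 * y ^ 2)

open Filter Topology

/-! ### Calculus of the partial derivatives of analytic functions of two variables. -/

section PartialDerivatives

variable {f g : ℂ × ℂ → ℂ} {p : ℂ × ℂ}

/-! Write `U = u⁻(x - y) - u⁺(x + y)` and compare `P₂` with `L = ∂x² + ∂y² - 2R = -2P`. Since `u⁻`
and `u⁺` solve the wave equation with opposite characteristics, while `v` and `w` each depend on one
variable, all coefficients of `[L, P₂]` of order two and more cancel. The function `T` enters only
through `∂x T`, `∂y T` in the first order coefficients and `∂x² T + ∂y² T` in the zeroth order one.
Everything vanishes as soon as `∂x T = 4 w (u⁺' + u⁻') - 2 (u⁻ - u⁺) w'` and `∂y T = 4 v (u⁺' - u⁻')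
- 2 (u⁻ - u⁺) v'`. This is an identity in any commutative ring with two commuting derivations
(`quarticOp_commute`). It is transferred to operators by applying it to the ring of holomorphic
functions on an open set `U` (`holomorphicOn`, `IsCompatible.commuteOn`).

What remains is to check the two equations for each family. If the data are symmetric in `x` and
`y`, one equation suffices; with `T = 2 (u⁻ + u⁺)(v + w) - 4 τ` it becomes the functional equation
`(u⁻' + u⁺')(v(x) - v(y)) + (u⁻ + u⁺) v'(x) + (u⁻ - u⁺) v'(y) = 2 ∂x τ`
(`IsCompatible.of_symm_of_eq`). Rational, hyperbolic and exponential families reduce to identities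
of rational functions after a choice of variables; for Trig-`B₂` these are `sinh² λx` and `sinh²
λy`.

In the elliptic family the equation is linear in the `C j`. For `v = ℘`, `τ = ℘(x) ℘(y)` the defect
is, for fixed `y`, an odd elliptic function of `x` whose possible poles at `0` and `±y` all cancel.
By Liouville's theorem it is constant, and an odd constant is zero
(`PeriodPair.additionDefect_eq_zero`). The terms with the other half periods follow by translating
`x` and `y` by `ω_j`: this fixes `x - y` and moves `x + y` by a period. -/

lemma partialX_eq_fderiv (hf : DifferentiableAt ℂ f p) : partialX f p = fderiv ℂ f p (1, 0) := by
  have h : HasDerivAt (fun s : ℂ => ((s, p.2) : ℂ × ℂ)) (1, 0) p.1 :=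
    (hasDerivAt_id p.1).prodMk (hasDerivAt_const p.1 p.2)
  exact (hf.hasFDerivAt.comp_hasDerivAt_of_eq p.1 h rfl).deriv

lemma partialY_eq_fderiv (hf : DifferentiableAt ℂ f p) : partialY f p = fderiv ℂ f p (0, 1) := by
  have h : HasDerivAt (fun t : ℂ => ((p.1, t) : ℂ × ℂ)) (0, 1) p.2 :=
    (hasDerivAt_const p.2 p.1).prodMk (hasDerivAt_id p.2)
  exact (hf.hasFDerivAt.comp_hasDerivAt_of_eq p.2 h rfl).deriv

lemma partialX_eventuallyEq_fderiv (hf : AnalyticAt ℂ f p) :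
    partialX f =ᶠ[𝓝 p] fun q => fderiv ℂ f q (1, 0) := by
  filter_upwards [hf.eventually_analyticAt] with q hq
  exact partialX_eq_fderiv hq.differentiableAt

lemma partialY_eventuallyEq_fderiv (hf : AnalyticAt ℂ f p) :
    partialY f =ᶠ[𝓝 p] fun q => fderiv ℂ f q (0, 1) := by
  filter_upwards [hf.eventually_analyticAt] with q hq
  exact partialY_eq_fderiv hq.differentiableAt

lemma AnalyticAt.fderiv_apply_const (hf : AnalyticAt ℂ f p) (v : ℂ × ℂ) :
    AnalyticAt ℂ (fun q => fderiv ℂ f q v) p :=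
  ((ContinuousLinearMap.apply ℂ ℂ v).analyticAt _).comp hf.fderiv

lemma AnalyticAt.partialX (hf : AnalyticAt ℂ f p) : AnalyticAt ℂ (partialX f) p :=
  (hf.fderiv_apply_const (1, 0)).congr (partialX_eventuallyEq_fderiv hf).symm

lemma AnalyticAt.partialY (hf : AnalyticAt ℂ f p) : AnalyticAt ℂ (partialY f) p :=
  (hf.fderiv_apply_const (0, 1)).congr (partialY_eventuallyEq_fderiv hf).symm

lemma AnalyticOnNhd.partialX {U : Set (ℂ × ℂ)} (hf : AnalyticOnNhd ℂ f U) :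
    AnalyticOnNhd ℂ (partialX f) U := fun p hp => (hf p hp).partialX

lemma AnalyticOnNhd.partialY {U : Set (ℂ × ℂ)} (hf : AnalyticOnNhd ℂ f U) :
    AnalyticOnNhd ℂ (partialY f) U := fun p hp => (hf p hp).partialY

lemma Filter.EventuallyEq.partialX_eq (h : f =ᶠ[𝓝 p] g) : partialX f p = partialX g p := by
  have hc : Tendsto (fun s : ℂ => ((s, p.2) : ℂ × ℂ)) (𝓝 p.1) (𝓝 p) :=
    (Continuous.prodMk_left p.2).tendsto' _ _ rfl
  exact (h.comp_tendsto hc).deriv_eq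

lemma Filter.EventuallyEq.partialY_eq (h : f =ᶠ[𝓝 p] g) : partialY f p = partialY g p := by
  have hc : Tendsto (fun s : ℂ => ((p.1, s) : ℂ × ℂ)) (𝓝 p.2) (𝓝 p) :=
    (Continuous.prodMk_right p.1).tendsto' _ _ rfl
  exact (h.comp_tendsto hc).deriv_eq

lemma partialX_add (hf : AnalyticAt ℂ f p) (hg : AnalyticAt ℂ g p) :
    partialX (f + g) p = partialX f p + partialX g p := by
  rw [partialX_eq_fderiv hf.differentiableAt, partialX_eq_fderiv hg.differentiableAt,
    partialX_eq_fderiv (hf.add hg).differentiableAt,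
    fderiv_add hf.differentiableAt hg.differentiableAt]
  rfl

lemma partialY_add (hf : AnalyticAt ℂ f p) (hg : AnalyticAt ℂ g p) :
    partialY (f + g) p = partialY f p + partialY g p := by
  rw [partialY_eq_fderiv hf.differentiableAt, partialY_eq_fderiv hg.differentiableAt,
    partialY_eq_fderiv (hf.add hg).differentiableAt,
    fderiv_add hf.differentiableAt hg.differentiableAt]
  rfl

lemma partialX_mul (hf : AnalyticAt ℂ f p) (hg : AnalyticAt ℂ g p) :
    partialX (f * g) p = f p * partialX g p + g p * partialX f p := by
  rw [partialX_eq_fderiv hf.differentiableAt, partialX_eq_fderiv hg.differentiableAt,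
    partialX_eq_fderiv (hf.mul hg).differentiableAt,
    fderiv_mul hf.differentiableAt hg.differentiableAt]
  rfl

lemma partialY_mul (hf : AnalyticAt ℂ f p) (hg : AnalyticAt ℂ g p) :
    partialY (f * g) p = f p * partialY g p + g p * partialY f p := by
  rw [partialY_eq_fderiv hf.differentiableAt, partialY_eq_fderiv hg.differentiableAt,
    partialY_eq_fderiv (hf.mul hg).differentiableAt,
    fderiv_mul hf.differentiableAt hg.differentiableAt]
  rfl

lemma fderiv_fderiv_apply_const (hf : AnalyticAt ℂ f p) (v w : ℂ × ℂ) :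
    fderiv ℂ (fun q => fderiv ℂ f q v) p w = fderiv ℂ (fderiv ℂ f) p w v := by
  rw [fderiv_clm_apply hf.fderiv.differentiableAt (differentiableAt_const v)]
  simp

/-- Both sides are values of the second Fréchet derivative, which is symmetric at a point of
analyticity. -/
lemma partialX_partialY (hf : AnalyticAt ℂ f p) :
    partialX (partialY f) p = partialY (partialX f) p := by
  rw [(partialY_eventuallyEq_fderiv hf).partialX_eq, (partialX_eventuallyEq_fderiv hf).partialY_eq,
    partialX_eq_fderiv (hf.fderiv_apply_const _).differentiableAt,
    partialY_eq_fderiv (hf.fderiv_apply_const _).differentiableAt,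
    fderiv_fderiv_apply_const hf, fderiv_fderiv_apply_const hf]
  exact (hf.contDiffAt.isSymmSndFDerivAt_of_omega) _ _

end PartialDerivatives

/-! ### The holomorphic functions on an open set as a ring with two commuting derivations. -/

section HolomorphicFunctions

/-- The ring of functions on `U` that are restrictions of functions analytic at the points of
`U`. -/
def holomorphicOn (U : Set (ℂ × ℂ)) : Subring (U → ℂ) where
  carrier := {g | ∃ f, AnalyticOnNhd ℂ f U ∧ ∀ p : U, f p = g p}
  mul_mem' := by
    rintro _ _ ⟨f, hf, hf'⟩ ⟨g, hg, hg'⟩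
    exact ⟨f * g, hf.mul hg, fun p => by simp [hf', hg']⟩
  one_mem' := ⟨1, analyticOnNhd_const, fun _ => rfl⟩
  add_mem' := by
    rintro _ _ ⟨f, hf, hf'⟩ ⟨g, hg, hg'⟩
    exact ⟨f + g, hf.add hg, fun p => by simp [hf', hg']⟩
  zero_mem' := ⟨0, analyticOnNhd_const, fun _ => rfl⟩
  neg_mem' := by
    rintro _ ⟨f, hf, hf'⟩
    exact ⟨-f, hf.neg, fun p => by simp [hf']⟩

namespace holomorphicOn

variable {U : Set (ℂ × ℂ)}

/-- The restriction to `U` of a function that is analytic at the points of `U`. -/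
def res (f : ℂ × ℂ → ℂ) (hf : AnalyticOnNhd ℂ f U) : holomorphicOn U :=
  ⟨fun p => f p, f, hf, fun _ => rfl⟩

/-- A function analytic at the points of `U` that extends `g`. -/
noncomputable def rep (g : holomorphicOn U) : ℂ × ℂ → ℂ := g.2.choose

lemma analyticOnNhd_rep (g : holomorphicOn U) : AnalyticOnNhd ℂ (rep g) U := g.2.choose_spec.1

lemma rep_apply (g : holomorphicOn U) (p : U) : (rep g) p = g.1 p := g.2.choose_spec.2 p

lemma res_rep (g : holomorphicOn U) : res (rep g) (analyticOnNhd_rep g) = g :=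
  Subtype.ext (funext (rep_apply g))

lemma res_eq_iff {f g : ℂ × ℂ → ℂ} {hf : AnalyticOnNhd ℂ f U} {hg : AnalyticOnNhd ℂ g U} :
    res f hf = res g hg ↔ ∀ p ∈ U, f p = g p := by
  refine ⟨fun h p hp => congrFun (congrArg Subtype.val h) ⟨p, hp⟩, fun h => ?_⟩
  exact Subtype.ext (funext fun p => h p p.2)

/-- The values of `rep` off `U` are an arbitrary choice. As `U` is open, they do not affect germs at
points of `U`, and germs determine the partial derivatives; hence `dx` and `dy` are independent of
the choice. -/
lemma rep_res_eventuallyEq (hU : IsOpen U) {f : ℂ × ℂ → ℂ} (hf : AnalyticOnNhd ℂ f U) {p : ℂ × ℂ}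
    (hp : p ∈ U) : (rep (res f hf)) =ᶠ[𝓝 p] f := by
  filter_upwards [hU.mem_nhds hp] with q hq
  exact rep_apply (res f hf) ⟨q, hq⟩

lemma rep_add_eventuallyEq (hU : IsOpen U) (f g : holomorphicOn U) {p : ℂ × ℂ}
    (hp : p ∈ U) : (rep (f + g)) =ᶠ[𝓝 p] (rep f) + (rep g) := by
  filter_upwards [hU.mem_nhds hp] with q hq
  have h := fun g : holomorphicOn U => rep_apply g ⟨q, hq⟩
  simp only [Pi.add_apply, h]
  rfl

lemma rep_mul_eventuallyEq (hU : IsOpen U) (f g : holomorphicOn U) {p : ℂ × ℂ}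
    (hp : p ∈ U) : (rep (f * g)) =ᶠ[𝓝 p] (rep f) * (rep g) := by
  filter_upwards [hU.mem_nhds hp] with q hq
  have h := fun g : holomorphicOn U => rep_apply g ⟨q, hq⟩
  simp only [Pi.mul_apply, h]
  rfl

/-- `∂/∂x` as a derivation. -/
noncomputable def dx (hU : IsOpen U) : Derivation ℤ (holomorphicOn U) (holomorphicOn U) :=
  Derivation.mk' (AddMonoidHom.mk' (fun g => res (partialX (rep g)) (analyticOnNhd_rep g).partialX)
    fun f g => Subtype.ext <| funext fun p => by
      change partialX (rep (f + g)) p = partialX (rep f) p + partialX (rep g) p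
      rw [(rep_add_eventuallyEq hU f g p.2).partialX_eq,
        partialX_add (analyticOnNhd_rep f p p.2) (analyticOnNhd_rep g p p.2)]).toIntLinearMap
    fun f g => Subtype.ext <| funext fun p => by
      change partialX (rep (f * g)) p = f.1 p * partialX (rep g) p + g.1 p * partialX (rep f) p
      rw [(rep_mul_eventuallyEq hU f g p.2).partialX_eq,
        partialX_mul (analyticOnNhd_rep f p p.2) (analyticOnNhd_rep g p p.2), rep_apply, rep_apply]

/-- `∂/∂y` as a derivation. -/
noncomputable def dy (hU : IsOpen U) : Derivation ℤ (holomorphicOn U) (holomorphicOn U) :=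
  Derivation.mk' (AddMonoidHom.mk' (fun g => res (partialY (rep g)) (analyticOnNhd_rep g).partialY)
    fun f g => Subtype.ext <| funext fun p => by
      change partialY (rep (f + g)) p = partialY (rep f) p + partialY (rep g) p
      rw [(rep_add_eventuallyEq hU f g p.2).partialY_eq,
        partialY_add (analyticOnNhd_rep f p p.2) (analyticOnNhd_rep g p p.2)]).toIntLinearMap
    fun f g => Subtype.ext <| funext fun p => by
      change partialY (rep (f * g)) p = f.1 p * partialY (rep g) p + g.1 p * partialY (rep f) p
      rw [(rep_mul_eventuallyEq hU f g p.2).partialY_eq,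
        partialY_mul (analyticOnNhd_rep f p p.2) (analyticOnNhd_rep g p p.2), rep_apply, rep_apply]

lemma dx_res (hU : IsOpen U) {f : ℂ × ℂ → ℂ} (hf : AnalyticOnNhd ℂ f U) :
    dx hU (res f hf) = res (partialX f) hf.partialX :=
  Subtype.ext <| funext fun p => (rep_res_eventuallyEq hU hf p.2).partialX_eq

lemma dy_res (hU : IsOpen U) {f : ℂ × ℂ → ℂ} (hf : AnalyticOnNhd ℂ f U) :
    dy hU (res f hf) = res (partialY f) hf.partialY :=
  Subtype.ext <| funext fun p => (rep_res_eventuallyEq hU hf p.2).partialY_eq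

lemma dx_dy (hU : IsOpen U) (g : holomorphicOn U) : dx hU (dy hU g) = dy hU (dx hU g) := by
  rw [← res_rep g, dy_res, dx_res, dx_res, dy_res, res_eq_iff]
  exact fun p hp => partialX_partialY (analyticOnNhd_rep g p hp)

end holomorphicOn

end HolomorphicFunctions

/-! ### The commutator identity in a ring with two commuting derivations. -/

section Commutator

variable {K : Type*} [CommRing K]

/-- The operator `(∂x ∂y + U)² - 2 w ∂x² - 2 v ∂y² + 4 v w + T`. -/
def quarticOp (dx dy : Derivation ℤ K K) (U v w T g : K) : K :=
  (dx (dy (dx (dy g) + U * g)) + U * (dx (dy g) + U * g)) - 2 * w * dx (dx g) - 2 * v * dy (dy g)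
    + 4 * v * w * g + T * g

/-- Collects the operator by powers of the derivations, so that the coefficients of its lower order
part can be read off. -/
theorem quarticOp_expand (dx dy : Derivation ℤ K K) (comm : ∀ a, dx (dy a) = dy (dx a))
    (U v w T g : K) :
    quarticOp dx dy U v w T g = dx (dx (dy (dy g))) + (dx (dy U) + U ^ 2 + 4 * v * w + T) * g
      + dx U * dy g + dy U * dx g + 2 * U * dx (dy g) - 2 * w * dx (dx g) - 2 * v * dy (dy g) := by
  simp only [quarticOp, map_add, Derivation.leibniz, smul_eq_mul, comm]
  ring

/-- Allows the factor `-1/2` in `P = -(1/2) L` to be moved through the fourth order operator, so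
that the commutator identity itself needs no division by two. -/
theorem quarticOp_const_mul (dx dy : Derivation ℤ K K) {c : K} (hx : dx c = 0) (hy : dy c = 0)
    (U v w T g : K) : quarticOp dx dy U v w T (c * g) = c * quarticOp dx dy U v w T g := by
  simp only [quarticOp, map_add, Derivation.leibniz, smul_eq_mul, hx, hy, mul_zero, add_zero]
  ring

/-- The terms of order two and three cancel because of the shapes of `um`, `up`, `v`, `w` alone. The
hypotheses `hTx` and `hTy` remove the first order terms and, once differentiated, the zeroth order
term. -/
theorem quarticOp_commute (dx dy : Derivation ℤ K K) (comm : ∀ a, dx (dy a) = dy (dx a))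
    {um up v w T : K} (hum : dy um = -dx um) (hup : dy up = dx up) (hv : dy v = 0) (hw : dx w = 0)
    (hTx : dx T = 4 * (w * (dx up + dx um)) - 2 * ((um - up) * dy w))
    (hTy : dy T = 4 * (v * (dy up + dy um)) - 2 * ((um - up) * dx v)) (g : K) :
    let L := fun h => dx (dx h) + dy (dy h) - 2 * ((up + um + v + w) * h)
    L (quarticOp dx dy (um - up) v w T g) = quarticOp dx dy (um - up) v w T (L g) := by
  intro L
  -- Normal form: `dx` is moved outside `dy`. Mixed derivatives of `v` then vanish through `hv`,
  -- while those of `w` need `hw1` and `hw2`. The Leibniz rule also differentiates the numerals,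
  -- whose derivatives must be recorded as zero.
  have c1 : ∀ a, dy (dx a) = dx (dy a) := fun a => (comm a).symm
  have hx2 : dx 2 = 0 := dx.map_natCast 2
  have hy2 : dy 2 = 0 := dy.map_natCast 2
  have hx4 : dx 4 = 0 := dx.map_natCast 4
  have hy4 : dy 4 = 0 := dy.map_natCast 4
  have hw1 : dx (dy w) = 0 := by rw [comm, hw, map_zero]
  have hw2 : dx (dy (dy w)) = 0 := by rw [comm, hw1, map_zero]
  simp only [L, quarticOp, map_add, map_sub, Derivation.leibniz, smul_eq_mul, c1, hum, hup, hv, hw,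
    hw1, hw2, hTx, hTy, map_neg, hx2, hy2, hx4, hy4, map_zero, mul_zero, add_zero, zero_add]
  ring

end Commutator

/-! ### From the algebraic identity to commuting differential operators. -/

section Criterion

/-- The functions `u⁻(x - y)`, `u⁺(x + y)`, `v(x)`, `w(y)`, `T(x, y)` are analytic on `D`, and the
partial derivatives of `T` are those for which the fourth order operator commutes with the
Schrödinger operator. -/
structure IsCompatible (D : Set (ℂ × ℂ)) (um up v w : ℂ → ℂ) (T : ℂ → ℂ → ℂ) : Prop where
  analyticAt_um : ∀ p ∈ D, AnalyticAt ℂ um (p.1 - p.2)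
  analyticAt_up : ∀ p ∈ D, AnalyticAt ℂ up (p.1 + p.2)
  analyticAt_v : ∀ p ∈ D, AnalyticAt ℂ v p.1
  analyticAt_w : ∀ p ∈ D, AnalyticAt ℂ w p.2
  analyticOnNhd_T : AnalyticOnNhd ℂ (fun q : ℂ × ℂ => T q.1 q.2) D
  hasDerivAt_x : ∀ p ∈ D, HasDerivAt (fun x => T x p.2)
    (4 * (w p.2 * (deriv up (p.1 + p.2) + deriv um (p.1 - p.2))) -
      2 * ((um (p.1 - p.2) - up (p.1 + p.2)) * deriv w p.2)) p.1
  hasDerivAt_y : ∀ p ∈ D, HasDerivAt (fun y => T p.1 y)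
    (4 * (v p.1 * (deriv up (p.1 + p.2) - deriv um (p.1 - p.2))) -
      2 * ((um (p.1 - p.2) - up (p.1 + p.2)) * deriv v p.1)) p.2

namespace IsCompatible

variable {D U : Set (ℂ × ℂ)} {um up v w : ℂ → ℂ} {T : ℂ → ℂ → ℂ}

lemma mono (h : IsCompatible D um up v w T) (hU : U ⊆ D) : IsCompatible U um up v w T where
  analyticAt_um p hp := h.analyticAt_um p (hU hp)
  analyticAt_up p hp := h.analyticAt_up p (hU hp)
  analyticAt_v p hp := h.analyticAt_v p (hU hp)
  analyticAt_w p hp := h.analyticAt_w p (hU hp)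
  analyticOnNhd_T p hp := h.analyticOnNhd_T p (hU hp)
  hasDerivAt_x p hp := h.hasDerivAt_x p (hU hp)
  hasDerivAt_y p hp := h.hasDerivAt_y p (hU hp)

lemma analyticOnNhd_um (h : IsCompatible D um up v w T) :
    AnalyticOnNhd ℂ (fun q : ℂ × ℂ => um (q.1 - q.2)) D := fun p hp =>
  (h.analyticAt_um p hp).comp_of_eq (f := fun q : ℂ × ℂ => q.1 - q.2)
    (analyticAt_fst.sub analyticAt_snd) rfl

lemma analyticOnNhd_up (h : IsCompatible D um up v w T) :
    AnalyticOnNhd ℂ (fun q : ℂ × ℂ => up (q.1 + q.2)) D := fun p hp =>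
  (h.analyticAt_up p hp).comp_of_eq (f := fun q : ℂ × ℂ => q.1 + q.2)
    (analyticAt_fst.add analyticAt_snd) rfl

lemma analyticOnNhd_v (h : IsCompatible D um up v w T) :
    AnalyticOnNhd ℂ (fun q : ℂ × ℂ => v q.1) D := fun p hp =>
  (h.analyticAt_v p hp).comp_of_eq (f := fun q : ℂ × ℂ => q.1) analyticAt_fst rfl

lemma analyticOnNhd_w (h : IsCompatible D um up v w T) :
    AnalyticOnNhd ℂ (fun q : ℂ × ℂ => w q.2) D := fun p hp =>
  (h.analyticAt_w p hp).comp_of_eq (f := fun q : ℂ × ℂ => q.2) analyticAt_snd rfl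

lemma analyticOnNhd_um_sub_up (h : IsCompatible D um up v w T) :
    AnalyticOnNhd ℂ (fun q : ℂ × ℂ => um (q.1 - q.2) - up (q.1 + q.2)) D :=
  h.analyticOnNhd_um.sub h.analyticOnNhd_up

lemma analyticOnNhd_mixedOp (h : IsCompatible D um up v w T) {f : ℂ × ℂ → ℂ}
    (hf : AnalyticOnNhd ℂ f D) : AnalyticOnNhd ℂ (mixedOp um up f) D :=
  hf.partialY.partialX.add (h.analyticOnNhd_um_sub_up.mul hf)

lemma analyticOnNhd_fourthOrderOp (h : IsCompatible D um up v w T) {f : ℂ × ℂ → ℂ}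
    (hf : AnalyticOnNhd ℂ f D) : AnalyticOnNhd ℂ (fourthOrderOp um up v w T f) D :=
  ((((h.analyticOnNhd_mixedOp (h.analyticOnNhd_mixedOp hf)).sub
    ((analyticOnNhd_const.mul h.analyticOnNhd_w).mul hf.partialX.partialX)).sub
    ((analyticOnNhd_const.mul h.analyticOnNhd_v).mul hf.partialY.partialY)).add
    (((analyticOnNhd_const.mul h.analyticOnNhd_v).mul h.analyticOnNhd_w).mul hf)).add
    (h.analyticOnNhd_T.mul hf)

open holomorphicOn

lemma res_mixedOp (hU : IsOpen U) (h : IsCompatible U um up v w T) {f : ℂ × ℂ → ℂ}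
    (hf : AnalyticOnNhd ℂ f U) : res (mixedOp um up f) (h.analyticOnNhd_mixedOp hf) =
      dx hU (dy hU (res f hf)) + (res _ h.analyticOnNhd_um - res _ h.analyticOnNhd_up) *
        res f hf := by
  rw [dy_res, dx_res]
  rfl

lemma res_fourthOrderOp (hU : IsOpen U) (h : IsCompatible U um up v w T) {f : ℂ × ℂ → ℂ}
    (hf : AnalyticOnNhd ℂ f U) :
    res (fourthOrderOp um up v w T f) (h.analyticOnNhd_fourthOrderOp hf) =
      quarticOp (dx hU) (dy hU) (res _ h.analyticOnNhd_um - res _ h.analyticOnNhd_up)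
        (res _ h.analyticOnNhd_v) (res _ h.analyticOnNhd_w) (res _ h.analyticOnNhd_T)
        (res f hf) := by
  rw [quarticOp, ← h.res_mixedOp hU hf, ← h.res_mixedOp hU (h.analyticOnNhd_mixedOp hf)]
  simp only [dx_res, dy_res]
  rfl

lemma hasLeadingPart (h : IsCompatible D um up v w T) :
    HasLeadingPart D (fourthOrderOp um up v w T) := by
  let u : ℂ × ℂ → ℂ := fun q => um (q.1 - q.2) - up (q.1 + q.2)
  have hu : AnalyticOnNhd ℂ u D := h.analyticOnNhd_um_sub_up
  -- The coefficients come from `quarticOp_expand`; `i` counts `∂x` and `j` counts `∂y`, so the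
  -- crossed terms put `∂x u` in front of `∂y` and `∂y u` in front of `∂x`.
  refine ⟨fun i j => match i, j with
    | 0, 0 => fun q => partialX (partialY u) q + u q ^ 2 + 4 * v q.1 * w q.2 + T q.1 q.2
    | 0, 1 => partialX u
    | 1, 0 => partialY u
    | 1, 1 => fun q => 2 * u q
    | 2, 0 => fun q => -2 * w q.2
    | 0, 2 => fun q => -2 * v q.1
    | _, _ => 0, fun i j => ?_, fun U hU hUD f hf p hp => ?_⟩
  · have hc : ∀ c : ℂ, AnalyticOnNhd ℂ (fun _ : ℂ × ℂ => c) D := fun c => analyticOnNhd_const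
    dsimp only
    split
    · exact ((hu.partialY.partialX.add (hu.pow 2)).add
        (((hc 4).mul h.analyticOnNhd_v).mul h.analyticOnNhd_w)).add h.analyticOnNhd_T
    · exact hu.partialX
    · exact hu.partialY
    · exact (hc 2).mul hu
    · exact (hc (-2)).mul h.analyticOnNhd_w
    · exact (hc (-2)).mul h.analyticOnNhd_v
    · exact hc 0
  · have h' := h.mono hUD
    have hu' : AnalyticOnNhd ℂ u U := hu.mono hUD
    have key := h'.res_fourthOrderOp hU hf
    rw [quarticOp_expand _ _ (dx_dy hU),
      show res _ h'.analyticOnNhd_um - res _ h'.analyticOnNhd_up = res u hu' from rfl] at key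
    simp only [dx_res, dy_res] at key
    refine (congrFun (congrArg Subtype.val key) ⟨p, hp⟩).trans ?_
    simp only [Finset.sum_range_succ, Finset.sum_range_zero, Nat.sub_zero, Nat.reduceSub, zero_add,
      Function.iterate_succ, Function.iterate_zero, Function.comp, id, Pi.zero_apply, zero_mul,
      add_zero]
    change partialX (partialX (partialY (partialY f))) p +
      (partialX (partialY u) p + u p ^ 2 + 4 * v p.1 * w p.2 + T p.1 p.2) * f p +
      partialX u p * partialY f p + partialY u p * partialX f p +
      2 * u p * partialX (partialY f) p - 2 * w p.2 * partialX (partialX f) p -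
      2 * v p.1 * partialY (partialY f) p = _
    ring

lemma commuteOn (h : IsCompatible D um up v w T) {R : ℂ → ℂ → ℂ}
    (hR : ∀ p ∈ D, R p.1 p.2 = up (p.1 + p.2) + um (p.1 - p.2) + v p.1 + w p.2) :
    CommuteOn D (schrodingerOp R) (fourthOrderOp um up v w T) := by
  intro U hU hUD f hf p hp
  replace h := h.mono hUD
  have hum : dy hU (res _ h.analyticOnNhd_um) = -dx hU (res _ h.analyticOnNhd_um) := by
    rw [dx_res, dy_res]
    refine res_eq_iff (hg := h.analyticOnNhd_um.partialX.neg).2 fun q hq => ?_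
    have := (h.analyticAt_um q hq).differentiableAt.hasDerivAt
    refine (this.comp_const_sub q.1 q.2).deriv.trans ?_
    exact congrArg _ (this.comp_sub_const q.1 q.2).deriv.symm
  have hup : dy hU (res _ h.analyticOnNhd_up) = dx hU (res _ h.analyticOnNhd_up) := by
    rw [dx_res, dy_res, res_eq_iff]
    intro q hq
    have := (h.analyticAt_up q hq).differentiableAt.hasDerivAt
    exact (this.comp_const_add q.1 q.2).deriv.trans (this.comp_add_const q.1 q.2).deriv.symm
  have hv : dy hU (res _ h.analyticOnNhd_v) = 0 := by
    rw [dy_res]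
    exact res_eq_iff (hg := analyticOnNhd_const (v := 0)).2 fun q _ => deriv_const q.2 (v q.1)
  have hw : dx hU (res _ h.analyticOnNhd_w) = 0 := by
    rw [dx_res]
    exact res_eq_iff (hg := analyticOnNhd_const (v := 0)).2 fun q _ => deriv_const q.1 (w q.2)
  have hTx : dx hU (res _ h.analyticOnNhd_T) = 4 * (res _ h.analyticOnNhd_w *
      (dx hU (res _ h.analyticOnNhd_up) + dx hU (res _ h.analyticOnNhd_um))) -
      2 * ((res _ h.analyticOnNhd_um - res _ h.analyticOnNhd_up) *
        dy hU (res _ h.analyticOnNhd_w)) := by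
    simp only [dx_res, dy_res]
    refine Subtype.ext (funext fun ⟨q, hq⟩ => (h.hasDerivAt_x q hq).deriv.trans ?_)
    have h1 := ((h.analyticAt_um q hq).differentiableAt.hasDerivAt.comp_sub_const q.1 q.2).deriv
    have h2 := ((h.analyticAt_up q hq).differentiableAt.hasDerivAt.comp_add_const q.1 q.2).deriv
    rw [← h1, ← h2]
    rfl
  have hTy : dy hU (res _ h.analyticOnNhd_T) = 4 * (res _ h.analyticOnNhd_v *
      (dy hU (res _ h.analyticOnNhd_up) + dy hU (res _ h.analyticOnNhd_um))) -
      2 * ((res _ h.analyticOnNhd_um - res _ h.analyticOnNhd_up) *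
        dx hU (res _ h.analyticOnNhd_v)) := by
    simp only [dx_res, dy_res]
    refine Subtype.ext (funext fun ⟨q, hq⟩ => (h.hasDerivAt_y q hq).deriv.trans ?_)
    have h1 := ((h.analyticAt_um q hq).differentiableAt.hasDerivAt.comp_const_sub q.1 q.2).deriv
    have h2 := ((h.analyticAt_up q hq).differentiableAt.hasDerivAt.comp_const_add q.1 q.2).deriv
    rw [sub_eq_add_neg (deriv up _), ← h1, ← h2]
    rfl
  -- On `U` the Schrödinger operator is `-(1/2) L` with the `L` of `quarticOp_commute`; below,
  -- `-(1/2)` is treated as a ring element killed by both derivations.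
  have hS : ∀ F : ℂ × ℂ → ℂ, ∀ hF : AnalyticOnNhd ℂ F U, ∀ q (hq : q ∈ U),
      schrodingerOp R F q = -(1 / 2) * (dx hU (dx hU (res F hF)) + dy hU (dy hU (res F hF)) -
        2 * ((res _ h.analyticOnNhd_up + res _ h.analyticOnNhd_um + res _ h.analyticOnNhd_v +
          res _ h.analyticOnNhd_w) * res F hF)).1 ⟨q, hq⟩ := by
    intro F hF q hq
    simp only [dx_res, dy_res, schrodingerOp, hR q (hUD hq)]
    change _ = -(1 / 2) * (partialX (partialX F) q + partialY (partialY F) q -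
      2 * ((up (q.1 + q.2) + um (q.1 - q.2) + v q.1 + w q.2) * F q))
    ring
  have hc : AnalyticOnNhd ℂ (fun _ : ℂ × ℂ => -(1 / 2 : ℂ)) U := analyticOnNhd_const
  have hcx : dx hU (res _ hc) = 0 := by
    rw [dx_res]
    exact res_eq_iff (hg := analyticOnNhd_const (v := 0)).2 fun q _ => deriv_const q.1 _
  have hcy : dy hU (res _ hc) = 0 := by
    rw [dy_res]
    exact res_eq_iff (hg := analyticOnNhd_const (v := 0)).2 fun q _ => deriv_const q.2 _
  have hSf : AnalyticOnNhd ℂ (schrodingerOp R f) U := by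
    have hcon : AnalyticOnNhd ℂ (fun q : ℂ × ℂ => -(1 / 2) * (partialX (partialX f) q +
        partialY (partialY f) q) + (up (q.1 + q.2) + um (q.1 - q.2) + v q.1 + w q.2) * f q) U :=
      (hc.mul (hf.partialX.partialX.add hf.partialY.partialY)).add
        ((((h.analyticOnNhd_up.add h.analyticOnNhd_um).add h.analyticOnNhd_v).add
          h.analyticOnNhd_w).mul hf)
    refine hcon.congr hU fun q hq => ?_
    simp only [schrodingerOp, hR q (hUD hq)]
  have key := quarticOp_commute (dx hU) (dy hU) (dx_dy hU) hum hup hv hw hTx hTy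
    (res f hf)
  have hres : res (schrodingerOp R f) hSf = res _ hc * (dx hU (dx hU (res f hf)) +
      dy hU (dy hU (res f hf)) - 2 * ((res _ h.analyticOnNhd_up + res _ h.analyticOnNhd_um +
        res _ h.analyticOnNhd_v + res _ h.analyticOnNhd_w) * res f hf)) :=
    Subtype.ext (funext fun q => hS f hf q q.2)
  have hBS := h.res_fourthOrderOp hU hSf
  rw [hres, quarticOp_const_mul _ _ hcx hcy, ← key, ← h.res_fourthOrderOp hU hf] at hBS
  rw [hS _ (h.analyticOnNhd_fourthOrderOp hf) p hp]
  exact (congrFun (congrArg Subtype.val hBS) ⟨p, hp⟩).symm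

theorem isCommuting (s : B2System) (h : IsCompatible s.domain s.um s.up s.v s.w s.T)
    (hR : ∀ p ∈ s.domain,
      s.R p.1 p.2 = s.up (p.1 + p.2) + s.um (p.1 - p.2) + s.v p.1 + s.w p.2) :
    s.IsCommuting :=
  ⟨hR, h.hasLeadingPart, h.commuteOn hR⟩

end IsCompatible

end Criterion

/-! ### Sufficient conditions for compatibility: explicit derivatives, symmetry, change of `T` by a
constant. -/

section Constructors

namespace IsCompatible

variable {D : Set (ℂ × ℂ)} {um up v w dum dup dv dw : ℂ → ℂ} {T τ dτ : ℂ → ℂ → ℂ}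

/-- A criterion for compatibility in terms of explicit derivatives. -/
theorem of_hasDerivAt
    (hum : ∀ p ∈ D, AnalyticAt ℂ um (p.1 - p.2)) (hup : ∀ p ∈ D, AnalyticAt ℂ up (p.1 + p.2))
    (hv : ∀ p ∈ D, AnalyticAt ℂ v p.1) (hw : ∀ p ∈ D, AnalyticAt ℂ w p.2)
    (hT : AnalyticOnNhd ℂ (fun q : ℂ × ℂ => T q.1 q.2) D)
    (hdum : ∀ p ∈ D, HasDerivAt um (dum (p.1 - p.2)) (p.1 - p.2))
    (hdup : ∀ p ∈ D, HasDerivAt up (dup (p.1 + p.2)) (p.1 + p.2))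
    (hdv : ∀ p ∈ D, HasDerivAt v (dv p.1) p.1) (hdw : ∀ p ∈ D, HasDerivAt w (dw p.2) p.2)
    (hTx : ∀ p ∈ D, HasDerivAt (fun x => T x p.2)
      (4 * (w p.2 * (dup (p.1 + p.2) + dum (p.1 - p.2))) -
        2 * ((um (p.1 - p.2) - up (p.1 + p.2)) * dw p.2)) p.1)
    (hTy : ∀ p ∈ D, HasDerivAt (fun y => T p.1 y)
      (4 * (v p.1 * (dup (p.1 + p.2) - dum (p.1 - p.2))) -
        2 * ((um (p.1 - p.2) - up (p.1 + p.2)) * dv p.1)) p.2) :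
    IsCompatible D um up v w T where
  analyticAt_um := hum
  analyticAt_up := hup
  analyticAt_v := hv
  analyticAt_w := hw
  analyticOnNhd_T := hT
  hasDerivAt_x p hp := by
    rw [(hdum p hp).deriv, (hdup p hp).deriv, (hdw p hp).deriv]
    exact hTx p hp
  hasDerivAt_y p hp := by
    rw [(hdum p hp).deriv, (hdup p hp).deriv, (hdv p hp).deriv]
    exact hTy p hp

/-- In a configuration that is symmetric in `x` and `y` it suffices to look at `∂T/∂x`. -/
theorem of_symm (hD : ∀ p ∈ D, p.swap ∈ D) (heven : ∀ t, um (-t) = um t)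
    (hsymm : ∀ x y, T x y = T y x)
    (hum : ∀ p ∈ D, AnalyticAt ℂ um (p.1 - p.2)) (hup : ∀ p ∈ D, AnalyticAt ℂ up (p.1 + p.2))
    (hv : ∀ p ∈ D, AnalyticAt ℂ v p.1)
    (hT : AnalyticOnNhd ℂ (fun q : ℂ × ℂ => T q.1 q.2) D)
    (hdum : ∀ p ∈ D, HasDerivAt um (dum (p.1 - p.2)) (p.1 - p.2))
    (hdup : ∀ p ∈ D, HasDerivAt up (dup (p.1 + p.2)) (p.1 + p.2))
    (hdv : ∀ p ∈ D, HasDerivAt v (dv p.1) p.1)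
    (hTx : ∀ p ∈ D, HasDerivAt (fun x => T x p.2)
      (4 * (v p.2 * (dup (p.1 + p.2) + dum (p.1 - p.2))) -
        2 * ((um (p.1 - p.2) - up (p.1 + p.2)) * dv p.2)) p.1) :
    IsCompatible D um up v v T := by
  refine of_hasDerivAt hum hup hv (fun p hp => hv _ (hD p hp)) hT hdum hdup hdv
    (fun p hp => hdv _ (hD p hp)) hTx fun p hp => ?_
  -- As `T` is symmetric, `∂T/∂y` at `p` is `∂T/∂x` at the swapped point. There `u⁺` is unchanged,
  -- the even function `u⁻` keeps its value and its derivative changes sign, which is the sign that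
  -- distinguishes the two equations.
  have h := hTx _ (hD p hp)
  have hodd : dum (p.2 - p.1) = -dum (p.1 - p.2) := by
    have h1 := hdum _ (hD p hp)
    have h2 : HasDerivAt (fun t => um (-t)) (-dum (p.1 - p.2)) (p.2 - p.1) := by
      have h3 := hdum p hp
      rw [← neg_sub] at h3
      simpa using! h3.comp (p.2 - p.1) (hasDerivAt_neg (p.2 - p.1))
    simp only [heven] at h2
    exact h1.unique h2
  have heven' : um (p.2 - p.1) = um (p.1 - p.2) := by rw [← neg_sub, heven]
  simp only [Prod.fst_swap, Prod.snd_swap, hodd, heven', add_comm p.2 p.1, hsymm _ p.1] at h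
  rw [sub_eq_add_neg]
  exact h

/-- The symmetric case with `T = 2 (u⁻ + u⁺) (v + w) - 4 τ`. -/
theorem of_symm_of_eq (hD : ∀ p ∈ D, p.swap ∈ D) (heven : ∀ t, um (-t) = um t)
    (hT : ∀ x y, T x y = 2 * (um (x - y) + up (x + y)) * (v x + v y) - 4 * τ x y)
    (hsymm : ∀ x y, τ x y = τ y x)
    (hum : ∀ p ∈ D, AnalyticAt ℂ um (p.1 - p.2)) (hup : ∀ p ∈ D, AnalyticAt ℂ up (p.1 + p.2))
    (hv : ∀ p ∈ D, AnalyticAt ℂ v p.1)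
    (hτ : AnalyticOnNhd ℂ (fun q : ℂ × ℂ => τ q.1 q.2) D)
    (hdum : ∀ p ∈ D, HasDerivAt um (dum (p.1 - p.2)) (p.1 - p.2))
    (hdup : ∀ p ∈ D, HasDerivAt up (dup (p.1 + p.2)) (p.1 + p.2))
    (hdv : ∀ p ∈ D, HasDerivAt v (dv p.1) p.1)
    (hdτ : ∀ p ∈ D, HasDerivAt (fun x => τ x p.2) (dτ p.1 p.2) p.1)
    (key : ∀ p ∈ D, (dum (p.1 - p.2) + dup (p.1 + p.2)) * (v p.1 - v p.2) +
      (um (p.1 - p.2) + up (p.1 + p.2)) * dv p.1 + (um (p.1 - p.2) - up (p.1 + p.2)) * dv p.2 =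
        2 * dτ p.1 p.2) :
    IsCompatible D um up v v T := by
  obtain rfl : T = fun x y => 2 * (um (x - y) + up (x + y)) * (v x + v y) - 4 * τ x y := by
    ext x y
    exact hT x y
  refine of_symm hD heven (fun x y => ?_) hum hup hv (fun p hp => ?_) hdum hdup hdv fun p hp => ?_
  · rw [hsymm x y, add_comm x y, ← neg_sub y x, heven, add_comm (v x)]
  · have h1 : AnalyticAt ℂ (fun q : ℂ × ℂ => um (q.1 - q.2)) p :=
      (hum p hp).comp_of_eq (f := fun q : ℂ × ℂ => q.1 - q.2)
        (analyticAt_fst.sub analyticAt_snd) rfl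
    have h2 : AnalyticAt ℂ (fun q : ℂ × ℂ => up (q.1 + q.2)) p :=
      (hup p hp).comp_of_eq (f := fun q : ℂ × ℂ => q.1 + q.2)
        (analyticAt_fst.add analyticAt_snd) rfl
    have h3 : AnalyticAt ℂ (fun q : ℂ × ℂ => v q.1) p :=
      (hv p hp).comp_of_eq (f := fun q : ℂ × ℂ => q.1) analyticAt_fst rfl
    have h4 : AnalyticAt ℂ (fun q : ℂ × ℂ => v q.2) p :=
      (hv _ (hD p hp)).comp_of_eq (f := fun q : ℂ × ℂ => q.2) analyticAt_snd rfl
    exact ((analyticAt_const.mul (h1.add h2)).mul (h3.add h4)).sub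
      (analyticAt_const.mul (hτ p hp))
  · have h1 := (hdum p hp).comp_sub_const p.1 p.2
    have h2 := (hdup p hp).comp_add_const p.1 p.2
    refine ((((h1.fun_add h2).const_mul 2).fun_mul ((hdv p hp).add_const (v p.2))).fun_sub
      ((hdτ p hp).const_mul 4)).congr_deriv ?_
    linear_combination 2 * key p hp

/-- Compatibility does not change if a constant is added to `T`. -/
theorem of_eq_add_const (hD : IsOpen D) (h : IsCompatible D um up v w T) {T' : ℂ → ℂ → ℂ} (c : ℂ)
    (hT : ∀ p ∈ D, T p.1 p.2 = T' p.1 p.2 + c) : IsCompatible D um up v w T' where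
  analyticAt_um := h.analyticAt_um
  analyticAt_up := h.analyticAt_up
  analyticAt_v := h.analyticAt_v
  analyticAt_w := h.analyticAt_w
  analyticOnNhd_T := (h.analyticOnNhd_T.sub (analyticOnNhd_const (v := c))).congr hD
    fun p hp => by simp [hT p hp]
  hasDerivAt_x p hp := by
    refine ((h.hasDerivAt_x p hp).sub_const c).congr_of_eventuallyEq ?_
    have hc : Tendsto (fun s : ℂ => ((s, p.2) : ℂ × ℂ)) (𝓝 p.1) (𝓝 p) :=
      (Continuous.prodMk_left p.2).tendsto' _ _ rfl
    filter_upwards [hc.eventually (hD.mem_nhds hp)] with x hx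
    exact eq_sub_of_add_eq (hT _ hx).symm
  hasDerivAt_y p hp := by
    refine ((h.hasDerivAt_y p hp).sub_const c).congr_of_eventuallyEq ?_
    have hc : Tendsto (fun s : ℂ => ((p.1, s) : ℂ × ℂ)) (𝓝 p.2) (𝓝 p) :=
      (Continuous.prodMk_right p.1).tendsto' _ _ rfl
    filter_upwards [hc.eventually (hD.mem_nhds hp)] with x hx
    exact eq_sub_of_add_eq (hT _ hx).symm

end IsCompatible

end Constructors

/-! ### The rational families. -/

section Rational

lemma hasDerivAt_div_sq (A : ℂ) {t : ℂ} (ht : t ≠ 0) :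
    HasDerivAt (fun t => A / t ^ 2) (-2 * A / t ^ 3) t := by
  refine ((hasDerivAt_const t A).fun_div (hasDerivAt_pow 2 t) (pow_ne_zero 2 ht)).congr_deriv ?_
  field_simp
  push_cast
  ring

lemma analyticAt_div_sq (A : ℂ) {t : ℂ} (ht : t ≠ 0) : AnalyticAt ℂ (fun t => A / t ^ 2) t :=
  analyticAt_const.fun_div (analyticAt_id.pow 2) (pow_ne_zero 2 ht)

attribute [local fun_prop] analyticAt_fst analyticAt_snd

theorem ratB2_isCompatible (A : ℂ) (C : Fin 4 → ℂ) :
    IsCompatible (ratB2 A C).domain (ratB2 A C).um (ratB2 A C).up (ratB2 A C).v (ratB2 A C).w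
      (ratB2 A C).T := by
  refine IsCompatible.of_symm_of_eq (dum := fun t => -2 * A / t ^ 3)
    (dup := fun t => -2 * A / t ^ 3)
    (dv := fun x => -2 * C 0 / x ^ 3 + C 1 * (2 * x) + C 2 * (4 * x ^ 3) + C 3 * (6 * x ^ 5))
    (τ := fun x y => A * (C 0 / (x ^ 2 * y ^ 2) + C 2 * (x ^ 2 + y ^ 2) +
      C 3 * (x ^ 4 + y ^ 4 + 3 * x ^ 2 * y ^ 2)))
    (dτ := fun x y => A * (-2 * C 0 / (x ^ 3 * y ^ 2) + C 2 * (2 * x) +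
      C 3 * (4 * x ^ 3 + 6 * x * y ^ 2))) ?_ (fun t => ?_) (fun x y => ?_) (fun x y => ?_)
    (fun p hp => analyticAt_div_sq A hp.2.2.1) (fun p hp => analyticAt_div_sq A hp.2.2.2)
    (fun p hp => ?_) (fun p hp => ?_) (fun p hp => hasDerivAt_div_sq A hp.2.2.1)
    (fun p hp => hasDerivAt_div_sq A hp.2.2.2) (fun p hp => ?_) (fun p hp => ?_) (fun p hp => ?_)
  · rintro ⟨x, y⟩ ⟨hx, hy, h1, h2⟩
    exact ⟨hy, hx, sub_ne_zero.2 (sub_ne_zero.1 h1).symm, by rwa [add_comm] at h2⟩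
  · simp [ratB2]
  · simp only [ratB2]; ring
  · ring
  · refine AnalyticAt.add (AnalyticAt.add (AnalyticAt.add (analyticAt_div_sq (C 0) hp.1) ?_) ?_) ?_
    all_goals fun_prop
  · have h : p.1 ^ 2 * p.2 ^ 2 ≠ 0 := mul_ne_zero (pow_ne_zero 2 hp.1) (pow_ne_zero 2 hp.2.1)
    fun_prop (disch := exact h)
  · refine ((((hasDerivAt_div_sq (C 0) hp.1).fun_add
      ((hasDerivAt_pow 2 p.1).const_mul (C 1))).fun_add
      ((hasDerivAt_pow 4 p.1).const_mul (C 2))).fun_add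
      ((hasDerivAt_pow 6 p.1).const_mul (C 3))).congr_deriv ?_
    push_cast
    ring
  · have h := (((hasDerivAt_div_sq (C 0 / p.2 ^ 2) hp.1).fun_add
      (((hasDerivAt_pow 2 p.1).add_const (p.2 ^ 2)).const_mul (C 2))).fun_add
      ((((hasDerivAt_pow 4 p.1).add_const (p.2 ^ 4)).fun_add
        (((hasDerivAt_pow 2 p.1).const_mul 3).mul_const (p.2 ^ 2))).const_mul (C 3))).const_mul A
    have hx := hp.1
    have hy := hp.2.1
    convert! h using 1
    · ext x
      rw [div_div, mul_comm (p.2 ^ 2)]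
    · push_cast
      field_simp
      ring
  · obtain ⟨hx, hy, h1, h2⟩ := hp
    simp only [ratB2]
    field_simp
    ring

theorem ratB2_isCommuting (A : ℂ) (C : Fin 4 → ℂ) : (ratB2 A C).IsCommuting :=
  (ratB2_isCompatible A C).isCommuting _ fun p _ => by simp only [ratB2]; ring

theorem ratB2_T_eq (A : ℂ) (C : Fin 4 → ℂ) (p : ℂ × ℂ) (hp : p ∈ (ratB2 A C).domain) :
    (ratB2 A C).T p.1 p.2 = (ratB2Alt A C).T p.1 p.2 + 4 * A * C 1 := by
  obtain ⟨hx, hy, h1, h2⟩ := hp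
  have h : p.1 ^ 2 - p.2 ^ 2 ≠ 0 := by
    rw [sq_sub_sq]
    exact mul_ne_zero h2 h1
  have h' : 1 / (p.1 - p.2) ^ 2 + 1 / (p.1 + p.2) ^ 2 =
      2 * (p.1 ^ 2 + p.2 ^ 2) / (p.1 ^ 2 - p.2 ^ 2) ^ 2 := by
    rw [sq_sub_sq, mul_pow]
    field_simp
    ring
  have hA : A / (p.1 - p.2) ^ 2 + A / (p.1 + p.2) ^ 2 =
      A * (2 * (p.1 ^ 2 + p.2 ^ 2) / (p.1 ^ 2 - p.2 ^ 2) ^ 2) := by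
    rw [← h']
    ring
  simp only [ratB2, ratB2Alt, hA]
  field_simp
  ring

lemma isOpen_ratB2_domain (A : ℂ) (C : Fin 4 → ℂ) : IsOpen (ratB2 A C).domain := by
  refine (isOpen_ne_fun continuous_fst continuous_const).inter
    ((isOpen_ne_fun continuous_snd continuous_const).inter
    ((isOpen_ne_fun (continuous_fst.sub continuous_snd) continuous_const).inter
    (isOpen_ne_fun (continuous_fst.add continuous_snd) continuous_const)))

theorem ratB2Alt_isCommuting (A : ℂ) (C : Fin 4 → ℂ) : (ratB2Alt A C).IsCommuting :=
  ((ratB2_isCompatible A C).of_eq_add_const (isOpen_ratB2_domain A C) (4 * A * C 1)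
    (ratB2_T_eq A C)).isCommuting (ratB2Alt A C) (ratB2_isCommuting A C).potential_eq

theorem ratA1Bry_isCommuting (A : ℂ) (C : Fin 4 → ℂ) : (ratA1Bry A C).IsCommuting := by
  refine IsCompatible.isCommuting _ (IsCompatible.of_symm (dum := fun t => -2 * A / t ^ 3)
    (dup := fun _ => 0) (dv := fun x => C 0 + C 1 * (2 * x) + C 2 * (3 * x ^ 2) + C 3 * (4 * x ^ 3))
    ?_ (fun t => ?_) (fun x y => ?_) (fun p hp => analyticAt_div_sq A hp)
    (fun p hp => analyticAt_const) (fun p hp => ?_) (fun p hp => ?_)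
    (fun p hp => hasDerivAt_div_sq A hp) (fun p hp => hasDerivAt_const _ _) (fun p hp => ?_)
    (fun p hp => ?_)) fun p _ => ?_
  · exact fun p hp => sub_ne_zero.2 (sub_ne_zero.1 hp).symm
  · simp [ratA1Bry]
  · simp only [ratA1Bry]
    rw [← neg_sub, neg_sq]
    ring
  · simp only [ratA1Bry]
    fun_prop
  · have h : (p.1 - p.2) ^ 2 ≠ 0 := pow_ne_zero 2 hp
    simp only [ratA1Bry]
    fun_prop (disch := exact h)
  · refine (((((hasDerivAt_id' p.1).const_mul (C 0)).fun_add
      ((hasDerivAt_pow 2 p.1).const_mul (C 1))).fun_add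
      ((hasDerivAt_pow 3 p.1).const_mul (C 2))).fun_add
      ((hasDerivAt_pow 4 p.1).const_mul (C 3))).congr_deriv ?_
    push_cast
    ring
  · have h1 := (hasDerivAt_div_sq (2 * A) hp).comp_sub_const p.1 p.2
    have h2 := ((((((hasDerivAt_id' p.1).add_const p.2).const_mul (C 0)).fun_add
      (((hasDerivAt_pow 2 p.1).add_const (p.2 ^ 2)).const_mul (C 1))).fun_add
      ((((hasDerivAt_id' p.1).const_mul (C 2)).mul_const p.2).fun_mul
        ((hasDerivAt_id' p.1).add_const p.2))).fun_add
      (((hasDerivAt_pow 2 p.1).const_mul (2 * C 3)).mul_const (p.2 ^ 2)))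
    refine (h1.fun_mul h2).congr_deriv ?_
    replace hp : p.1 - p.2 ≠ 0 := hp
    simp only [ratA1Bry]
    push_cast
    field_simp
    ring
  · simp only [ratA1Bry]
    ring

end Rational

/-! ### The hyperbolic and exponential families. -/

section Hyperbolic

attribute [local fun_prop] analyticAt_fst analyticAt_snd

lemma analyticAt_sinhNegSq {t : ℂ} (h : Complex.sinh t ≠ 0) : AnalyticAt ℂ sinhNegSq t :=
  analyticAt_const.fun_div ((Complex.differentiable_sinh.analyticAt t).pow 2) (pow_ne_zero 2 h)

lemma analyticAt_coshNegSq {t : ℂ} (h : Complex.cosh t ≠ 0) : AnalyticAt ℂ coshNegSq t :=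
  analyticAt_const.fun_div ((Complex.differentiable_cosh.analyticAt t).pow 2) (pow_ne_zero 2 h)

lemma analyticAt_sinhNegSq_mul (c : ℂ) {t : ℂ} (h : Complex.sinh (c * t) ≠ 0) :
    AnalyticAt ℂ (fun t => sinhNegSq (c * t)) t :=
  (analyticAt_sinhNegSq h).comp_of_eq (f := fun t => c * t) (by fun_prop) rfl

lemma analyticAt_coshNegSq_mul (c : ℂ) {t : ℂ} (h : Complex.cosh (c * t) ≠ 0) :
    AnalyticAt ℂ (fun t => coshNegSq (c * t)) t :=
  (analyticAt_coshNegSq h).comp_of_eq (f := fun t => c * t) (by fun_prop) rfl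

lemma Complex.hasDerivAt_exp_mul (c t : ℂ) :
    HasDerivAt (fun t => exp (c * t)) (c * exp (c * t)) t := by
  refine ((hasDerivAt_id' t).const_mul c).cexp.congr_deriv ?_
  ring

lemma Complex.hasDerivAt_sinh_mul (c t : ℂ) :
    HasDerivAt (fun t => sinh (c * t)) (c * cosh (c * t)) t := by
  refine ((hasDerivAt_id' t).const_mul c).csinh.congr_deriv ?_
  ring

lemma Complex.hasDerivAt_cosh_mul (c t : ℂ) :
    HasDerivAt (fun t => cosh (c * t)) (c * sinh (c * t)) t := by
  refine ((hasDerivAt_id' t).const_mul c).ccosh.congr_deriv ?_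
  ring

lemma hasDerivAt_sinhNegSq_mul (c : ℂ) {t : ℂ} (h : Complex.sinh (c * t) ≠ 0) :
    HasDerivAt (fun t => sinhNegSq (c * t))
      (-2 * c * Complex.cosh (c * t) / Complex.sinh (c * t) ^ 3) t := by
  refine ((hasDerivAt_const t (1 : ℂ)).fun_div ((Complex.hasDerivAt_sinh_mul c t).fun_pow 2)
    (pow_ne_zero 2 h)).congr_deriv ?_
  push_cast
  field_simp
  ring

lemma hasDerivAt_coshNegSq_mul (c : ℂ) {t : ℂ} (h : Complex.cosh (c * t) ≠ 0) :
    HasDerivAt (fun t => coshNegSq (c * t))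
      (-2 * c * Complex.sinh (c * t) / Complex.cosh (c * t) ^ 3) t := by
  refine ((hasDerivAt_const t (1 : ℂ)).fun_div ((Complex.hasDerivAt_cosh_mul c t).fun_pow 2)
    (pow_ne_zero 2 h)).congr_deriv ?_
  push_cast
  field_simp
  ring

lemma sinhNegSq_neg (t : ℂ) : sinhNegSq (-t) = sinhNegSq t := by simp [sinhNegSq]

namespace Complex

lemma exp_neg_two_mul (l t : ℂ) : exp (-2 * l * t) = (exp (2 * l * t))⁻¹ := by
  rw [← exp_neg]
  ring_nf

lemma exp_four_mul (l t : ℂ) : exp (4 * l * t) = exp (2 * l * t) ^ 2 := by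
  rw [← exp_nat_mul]
  push_cast
  ring_nf

lemma exp_neg_four_mul (l t : ℂ) : exp (-4 * l * t) = (exp (2 * l * t) ^ 2)⁻¹ := by
  rw [← exp_four_mul, ← exp_neg]
  ring_nf

lemma sinh_two_mul_mul (l t : ℂ) : sinh (2 * l * t) = 2 * sinh (l * t) * cosh (l * t) := by
  rw [mul_assoc, sinh_two_mul]

lemma cosh_two_mul_mul (l t : ℂ) : cosh (2 * l * t) = cosh (l * t) ^ 2 + sinh (l * t) ^ 2 := by
  rw [mul_assoc, cosh_two_mul]

end Complex

open Complex

theorem todaC2_isCommuting (lam A : ℂ) (C : Fin 4 → ℂ) : (todaC2 lam A C).IsCommuting := by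
  refine IsCompatible.isCommuting _ (IsCompatible.of_hasDerivAt
    (dum := fun t => A * (-2 * lam * exp (-2 * lam * t))) (dup := fun _ => 0)
    (dv := fun x => C 0 * (2 * lam * exp (2 * lam * x)) + C 1 * (4 * lam * exp (4 * lam * x)))
    (dw := fun y => C 2 * (-2 * lam * exp (-2 * lam * y)) + C 3 * (-4 * lam * exp (-4 * lam * y)))
    (fun p _ => ?_) (fun p _ => ?_) (fun p _ => ?_) (fun p _ => ?_) (fun p _ => ?_)
    (fun p _ => (hasDerivAt_exp_mul _ _).const_mul A) (fun p _ => hasDerivAt_const _ _)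
    (fun p _ => ((hasDerivAt_exp_mul _ _).const_mul _).fun_add
      ((hasDerivAt_exp_mul _ _).const_mul _))
    (fun p _ => ((hasDerivAt_exp_mul _ _).const_mul _).fun_add
      ((hasDerivAt_exp_mul _ _).const_mul _))
    (fun p _ => ?_) (fun p _ => ?_)) fun p _ => ?_
  any_goals simp only [todaC2]; fun_prop
  · refine (((hasDerivAt_exp_mul (-2 * lam) p.1).const_mul (C 2)).const_add
      (C 0 * exp (2 * lam * p.2))).const_mul (2 * A) |>.congr_deriv ?_
    simp only [todaC2, exp_neg_two_mul, exp_neg_four_mul, mul_sub (2 * lam), exp_sub]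
    field_simp [exp_ne_zero]
    ring
  · refine (((hasDerivAt_exp_mul (2 * lam) p.2).const_mul (C 0)).add_const
      (C 2 * exp (-2 * lam * p.1))).const_mul (2 * A) |>.congr_deriv ?_
    simp only [todaC2, exp_neg_two_mul, exp_four_mul, mul_sub (2 * lam), exp_sub]
    field_simp [exp_ne_zero]
    ring
  · simp only [todaC2]
    ring

theorem todaD2Bry_isCommuting (lam A : ℂ) (C : Fin 4 → ℂ) : (todaD2Bry lam A C).IsCommuting := by
  -- By the double angle formula, one condition on `sinh 2λt` also excludes the poles of `sinh⁻²
  -- λt`.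
  have hne : ∀ t, sinh (2 * lam * t) ≠ 0 → sinh (lam * t) ≠ 0 ∧ cosh (lam * t) ≠ 0 := by
    intro t ht
    rw [sinh_two_mul_mul] at ht
    simpa using ht
  have hV : ∀ c d t, sinh (2 * lam * t) ≠ 0 → HasDerivAt
      (fun t => c * sinhNegSq (lam * t) + d * sinhNegSq (2 * lam * t))
      (c * (-2 * lam * cosh (lam * t) / sinh (lam * t) ^ 3) +
        d * (-2 * (2 * lam) * cosh (2 * lam * t) / sinh (2 * lam * t) ^ 3)) t := fun c d t ht =>
    ((hasDerivAt_sinhNegSq_mul _ (hne t ht).1).const_mul c).fun_add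
      ((hasDerivAt_sinhNegSq_mul _ ht).const_mul d)
  have hVa : ∀ c d t, sinh (2 * lam * t) ≠ 0 → AnalyticAt ℂ
      (fun t => c * sinhNegSq (lam * t) + d * sinhNegSq (2 * lam * t)) t := fun c d t ht =>
    (analyticAt_const.mul (analyticAt_sinhNegSq_mul _ (hne t ht).1)).add
      (analyticAt_const.mul (analyticAt_sinhNegSq_mul _ ht))
  refine IsCompatible.isCommuting _ (IsCompatible.of_hasDerivAt
    (dum := fun t => A * (2 * lam * sinh (2 * lam * t)))
    (dup := fun t => A * (2 * lam * sinh (2 * lam * t)))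
    (dv := fun t => C 0 * (-2 * lam * cosh (lam * t) / sinh (lam * t) ^ 3) +
        C 1 * (-2 * (2 * lam) * cosh (2 * lam * t) / sinh (2 * lam * t) ^ 3))
    (dw := fun t => C 2 * (-2 * lam * cosh (lam * t) / sinh (lam * t) ^ 3) +
        C 3 * (-2 * (2 * lam) * cosh (2 * lam * t) / sinh (2 * lam * t) ^ 3))
    (fun p hp => by simp only [todaD2Bry]; fun_prop)
    (fun p hp => by simp only [todaD2Bry]; fun_prop) (fun p hp => hVa _ _ _ hp.1)
    (fun p hp => hVa _ _ _ hp.2) (fun p hp => ?_)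
    (fun p _ => (hasDerivAt_cosh_mul _ _).const_mul A)
    (fun p _ => (hasDerivAt_cosh_mul _ _).const_mul A)
    (fun p hp => hV _ _ _ hp.1) (fun p hp => hV _ _ _ hp.2)
    (fun p hp => ?_) (fun p hp => ?_)) fun p _ => ?_
  · simp only [todaD2Bry]
    fun_prop
  · refine (((hasDerivAt_cosh_mul (2 * lam) p.1).const_mul (C 2)).const_add
      (C 0 * cosh (2 * lam * p.2))).const_mul (8 * A) |>.congr_deriv ?_
    have h := hne _ hp.2
    simp only [todaD2Bry, sinhNegSq, mul_sub (2 * lam), mul_add (2 * lam), cosh_add, cosh_sub,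
      sinh_add, sinh_sub]
    -- Only `y` is passed to the half argument, because `w` mixes `λy` and `2λy`; the functions of
    -- `2λx` stay as independent variables.
    simp only [sinh_two_mul_mul lam p.2, cosh_two_mul_mul lam p.2]
    field_simp [h.1, h.2]
    ring
  · refine (((hasDerivAt_cosh_mul (2 * lam) p.2).const_mul (C 0)).add_const
      (C 2 * cosh (2 * lam * p.1))).const_mul (8 * A) |>.congr_deriv ?_
    have h := hne _ hp.1
    simp only [todaD2Bry, sinhNegSq, mul_sub (2 * lam), mul_add (2 * lam), cosh_add, cosh_sub,
      sinh_add, sinh_sub]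
    simp only [sinh_two_mul_mul lam p.1, cosh_two_mul_mul lam p.1]
    field_simp [h.1, h.2]
    ring
  · simp only [todaD2Bry]
    ring

theorem todaB2Bry_isCommuting (lam A : ℂ) (C : Fin 4 → ℂ) : (todaB2Bry lam A C).IsCommuting := by
  have hne : ∀ t, sinh (2 * lam * t) ≠ 0 → sinh (lam * t) ≠ 0 ∧ cosh (lam * t) ≠ 0 := by
    intro t ht
    rw [sinh_two_mul_mul] at ht
    simpa using ht
  refine IsCompatible.isCommuting _ (IsCompatible.of_hasDerivAt
    (dum := fun t => A * (-2 * lam * exp (-2 * lam * t)))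
    (dup := fun t => A * (-2 * lam * exp (-2 * lam * t)))
    (dv := fun x => C 0 * (2 * lam * exp (2 * lam * x)) + C 1 * (4 * lam * exp (4 * lam * x)))
    (dw := fun t => C 2 * (-2 * lam * cosh (lam * t) / sinh (lam * t) ^ 3) +
        C 3 * (-2 * (2 * lam) * cosh (2 * lam * t) / sinh (2 * lam * t) ^ 3))
    (fun p _ => ?_) (fun p _ => ?_) (fun p _ => ?_)
    (fun p hp => (analyticAt_const.mul (analyticAt_sinhNegSq_mul _ (hne _ hp).1)).add
      (analyticAt_const.mul (analyticAt_sinhNegSq_mul _ hp))) (fun p hp => ?_)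
    (fun p _ => (hasDerivAt_exp_mul _ _).const_mul A)
    (fun p _ => (hasDerivAt_exp_mul _ _).const_mul A)
    (fun p _ => ((hasDerivAt_exp_mul _ _).const_mul _).fun_add
      ((hasDerivAt_exp_mul _ _).const_mul _))
    (fun p hp => ((hasDerivAt_sinhNegSq_mul _ (hne _ hp).1).const_mul _).fun_add
      ((hasDerivAt_sinhNegSq_mul _ hp).const_mul _))
    (fun p hp => ?_) (fun p hp => ?_)) fun p _ => ?_
  any_goals simp only [todaB2Bry]; fun_prop
  all_goals
    -- Everything is expressed through `exp (2λx)`, `cosh λy` and `sinh λy`: the exponentials in `y`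
    -- coming from `u⁻` and `u⁺` become the squares `(cosh λy ± sinh λy)²`.
    have hexp : exp (2 * lam * p.2) = (cosh (lam * p.2) + sinh (lam * p.2)) ^ 2 := by
      rw [cosh_add_sinh, ← exp_nat_mul]
      push_cast
      ring_nf
    have hexp' : exp (-(2 * lam * p.2)) = (cosh (lam * p.2) - sinh (lam * p.2)) ^ 2 := by
      rw [cosh_sub_sinh, ← exp_nat_mul]
      push_cast
      ring_nf
    have hm : exp (-2 * lam * (p.1 - p.2)) =
        (exp (2 * lam * p.1))⁻¹ * (cosh (lam * p.2) + sinh (lam * p.2)) ^ 2 := by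
      rw [← hexp, ← exp_neg, ← exp_add]
      ring_nf
    have hp' : exp (-2 * lam * (p.1 + p.2)) =
        (exp (2 * lam * p.1))⁻¹ * (cosh (lam * p.2) - sinh (lam * p.2)) ^ 2 := by
      rw [← hexp', ← exp_neg, ← exp_add]
      ring_nf
  · refine (((hasDerivAt_exp_mul (-2 * lam) p.1).const_mul (2 * C 2)).const_add
      (C 0 * cosh (2 * lam * p.2))).const_mul (4 * A) |>.congr_deriv ?_
    have h := hne _ hp
    simp only [todaB2Bry, sinhNegSq, hm, hp']
    simp only [exp_neg_two_mul, sinh_two_mul_mul, cosh_two_mul_mul]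
    field_simp [h.1, h.2, exp_ne_zero]
    ring
  · refine (((hasDerivAt_cosh_mul (2 * lam) p.2).const_mul (C 0)).add_const
      (2 * C 2 * exp (-2 * lam * p.1))).const_mul (4 * A) |>.congr_deriv ?_
    simp only [todaB2Bry, hm, hp', exp_four_mul, sinh_two_mul_mul]
    field_simp [exp_ne_zero]
    ring
  · simp only [todaB2Bry]
    ring

theorem trigA1Bry_isCommuting (lam A : ℂ) (C : Fin 4 → ℂ) : (trigA1Bry lam A C).IsCommuting := by
  refine IsCompatible.isCommuting _ (IsCompatible.of_symm
    (dum := fun t => A * (-2 * lam * cosh (lam * t) / sinh (lam * t) ^ 3)) (dup := fun _ => 0)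
    (dv := fun x => C 0 * (-2 * lam * exp (-2 * lam * x)) + C 1 * (-4 * lam * exp (-4 * lam * x)) +
      C 2 * (2 * lam * exp (2 * lam * x)) + C 3 * (4 * lam * exp (4 * lam * x)))
    (fun p hp => ?_) (fun t => ?_) (fun x y => ?_)
    (fun p hp => analyticAt_const.mul (analyticAt_sinhNegSq_mul _ hp))
    (fun p hp => analyticAt_const) (fun p hp => ?_) (fun p hp => ?_)
    (fun p hp => (hasDerivAt_sinhNegSq_mul _ hp).const_mul A)
    (fun p hp => hasDerivAt_const _ _)
    (fun p hp => ((((hasDerivAt_exp_mul _ _).const_mul _).fun_add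
      ((hasDerivAt_exp_mul _ _).const_mul _)).fun_add
      ((hasDerivAt_exp_mul _ _).const_mul _)).fun_add ((hasDerivAt_exp_mul _ _).const_mul _))
    (fun p hp => ?_)) fun p _ => ?_
  · change sinh (lam * (p.2 - p.1)) ≠ 0
    rw [← neg_sub, mul_neg, sinh_neg]
    exact neg_ne_zero.2 hp
  · simp [trigA1Bry, sinhNegSq_neg]
  · simp only [trigA1Bry]
    rw [← neg_sub y x, mul_neg, sinhNegSq_neg, add_comm x y]
    ring
  · simp only [trigA1Bry]
    fun_prop
  · have h : AnalyticAt ℂ (fun q : ℂ × ℂ => sinhNegSq (lam * (q.1 - q.2))) p :=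
      (analyticAt_sinhNegSq_mul lam hp).comp_of_eq (f := fun q : ℂ × ℂ => q.1 - q.2)
        (analyticAt_fst.sub analyticAt_snd) rfl
    simp only [trigA1Bry]
    fun_prop
  · have h1 := (hasDerivAt_sinhNegSq_mul lam hp).comp_sub_const p.1 p.2
    have h2 := ((((((hasDerivAt_exp_mul (-2 * lam) p.1).add_const
      (exp (-2 * lam * p.2))).const_mul (C 0)).fun_add
      (((hasDerivAt_exp_mul (-2 * lam) (p.1 + p.2)).comp_add_const p.1 p.2).const_mul
        (2 * C 1))).fun_add
      (((hasDerivAt_exp_mul (2 * lam) p.1).add_const (exp (2 * lam * p.2))).const_mul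
        (C 2))).fun_add
      (((hasDerivAt_exp_mul (2 * lam) (p.1 + p.2)).comp_add_const p.1 p.2).const_mul
        (2 * C 3)))
    refine ((h1.const_mul (2 * A)).fun_mul h2).congr_deriv ?_
    have hs : sinh (lam * (p.1 - p.2)) ≠ 0 := hp
    -- This is `coth λ(x - y) = (P + Q)/(P - Q)` for `P = exp (2λx)`, `Q = exp (2λy)`, without
    -- denominators. It is the only relation needed between the hyperbolic functions and the
    -- exponentials.
    have hcoth : cosh (lam * (p.1 - p.2)) * (exp (2 * lam * p.1) - exp (2 * lam * p.2)) =
        sinh (lam * (p.1 - p.2)) * (exp (2 * lam * p.1) + exp (2 * lam * p.2)) := by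
      have e1 : exp (2 * lam * p.1) = exp (lam * p.1) ^ 2 := by
        rw [← exp_nat_mul]; push_cast; ring_nf
      have e2 : exp (2 * lam * p.2) = exp (lam * p.2) ^ 2 := by
        rw [← exp_nat_mul]; push_cast; ring_nf
      rw [e1, e2, cosh, sinh, exp_neg, mul_sub lam, exp_sub]
      field_simp [exp_ne_zero]
    simp only [trigA1Bry, sinhNegSq, exp_neg_two_mul, exp_four_mul, exp_neg_four_mul,
      mul_add (2 * lam), exp_add]
    have hP : exp (2 * lam * p.1) ≠ 0 := exp_ne_zero _
    have hQ : exp (2 * lam * p.2) ≠ 0 := exp_ne_zero _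
    generalize exp (2 * lam * p.1) = P at *
    generalize exp (2 * lam * p.2) = Q at *
    generalize sinh (lam * (p.1 - p.2)) = σ at *
    -- With `T = 2A sinh⁻² λ(x - y) B`, the terms containing `cosh` add up to `-4Aλ cosh/σ³` times
    -- `B - 2 v(y)`. The second factor here is the quotient of `B - 2 v(y)` by `P - Q`.
    linear_combination (norm := skip) (-4 * A * lam / σ ^ 3) *
      (-C 0 / (P * Q) - 2 * C 1 / (P * Q ^ 2) + C 2 + 2 * C 3 * Q) * hcoth
    field_simp
    ring
  · simp only [trigA1Bry]
    ring

/-- The functional equation for Trig-`B₂` in the variables `X = sinh² λx`, `Y = sinh² λy`, after the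
common factor `2Aλ sinh λx cosh λx` is removed. Here `1 + X = cosh² λx`, and the potential `v`
becomes `C₀/X + C₁/(1 + X) + C₂ X + C₃ X (1 + X)`. -/
lemma trigB2_rational_identity (C : Fin 4 → ℂ) {X Y : ℂ} (hX : X ≠ 0) (hX' : 1 + X ≠ 0)
    (hY : Y ≠ 0) (hY' : 1 + Y ≠ 0) (hXY : X - Y ≠ 0) :
    -2 * ((1 + Y) * (X * (1 + Y) + 3 * (1 + X) * Y) - Y * (3 * X * (1 + Y) + (1 + X) * Y)) /
        (X - Y) ^ 3 * ((C 0 / X + C 1 / (1 + X) + C 2 * X + C 3 * X * (1 + X)) -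
          (C 0 / Y + C 1 / (1 + Y) + C 2 * Y + C 3 * Y * (1 + Y))) +
      2 * (X * (1 + Y) + (1 + X) * Y) / (X - Y) ^ 2 *
        (-C 0 / X ^ 2 - C 1 / (1 + X) ^ 2 + C 2 + C 3 * (1 + 2 * X)) +
      4 * (Y * (1 + Y)) / (X - Y) ^ 2 *
        (-C 0 / Y ^ 2 - C 1 / (1 + Y) ^ 2 + C 2 + C 3 * (1 + 2 * Y)) =
    2 * (-C 0 / (X ^ 2 * Y) + C 1 / ((1 + X) ^ 2 * (1 + Y)) + C 3 * (1 + 2 * Y)) := by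
  field_simp
  ring

theorem trigB2_isCommuting (lam A : ℂ) (C : Fin 4 → ℂ) : (trigB2 lam A C).IsCommuting := by
  refine IsCompatible.isCommuting _ (IsCompatible.of_symm_of_eq
    (dum := fun t => A * (-2 * lam * cosh (lam * t) / sinh (lam * t) ^ 3))
    (dup := fun t => A * (-2 * lam * cosh (lam * t) / sinh (lam * t) ^ 3))
    (dv := fun t => 2 * lam * (sinh (lam * t) * cosh (lam * t)) *
      (-C 0 / (sinh (lam * t) ^ 2) ^ 2 - C 1 / (1 + sinh (lam * t) ^ 2) ^ 2 + C 2 +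
        C 3 * (1 + 2 * sinh (lam * t) ^ 2)))
    (τ := fun x y => A * (C 0 * sinhNegSq (lam * x) * sinhNegSq (lam * y) -
      C 1 * coshNegSq (lam * x) * coshNegSq (lam * y) +
      C 3 * (sinh (lam * x) ^ 2 + sinh (lam * y) ^ 2 + 2 * sinh (lam * x) ^ 2 * sinh (lam * y) ^ 2)))
    (dτ := fun x y => A * (2 * lam * (sinh (lam * x) * cosh (lam * x)) *
      (-C 0 / ((sinh (lam * x) ^ 2) ^ 2 * sinh (lam * y) ^ 2) +
        C 1 / ((1 + sinh (lam * x) ^ 2) ^ 2 * (1 + sinh (lam * y) ^ 2)) +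
        C 3 * (1 + 2 * sinh (lam * y) ^ 2))))
    (fun p hp => ?_) (fun t => ?_) (fun x y => ?_) (fun x y => ?_)
    (fun p hp => analyticAt_const.mul (analyticAt_sinhNegSq_mul _ hp.1))
    (fun p hp => analyticAt_const.mul (analyticAt_sinhNegSq_mul _ hp.2.1))
    (fun p hp => ?_) (fun p hp => ?_)
    (fun p hp => (hasDerivAt_sinhNegSq_mul _ hp.1).const_mul A)
    (fun p hp => (hasDerivAt_sinhNegSq_mul _ hp.2.1).const_mul A)
    (fun p hp => ?_) (fun p hp => ?_) (fun p hp => ?_)) fun p _ => ?_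
  · obtain ⟨h1, h2, h3, h4, h5, h6⟩ := hp
    refine ⟨?_, by rwa [Prod.fst_swap, Prod.snd_swap, add_comm], h5, h6, h3, h4⟩
    rw [Prod.fst_swap, Prod.snd_swap, ← neg_sub, mul_neg, sinh_neg]
    exact neg_ne_zero.2 h1
  · simp [trigB2, sinhNegSq_neg]
  · simp only [trigB2]
    ring
  · ring
  · have h1 := analyticAt_sinhNegSq_mul lam hp.2.2.1
    have h2 := analyticAt_coshNegSq_mul lam hp.2.2.2.1
    simp only [trigB2]
    fun_prop
  · have h1 : AnalyticAt ℂ (fun q : ℂ × ℂ => sinhNegSq (lam * q.1)) p :=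
      (analyticAt_sinhNegSq_mul lam hp.2.2.1).comp_of_eq analyticAt_fst rfl
    have h2 : AnalyticAt ℂ (fun q : ℂ × ℂ => coshNegSq (lam * q.1)) p :=
      (analyticAt_coshNegSq_mul lam hp.2.2.2.1).comp_of_eq analyticAt_fst rfl
    have h3 : AnalyticAt ℂ (fun q : ℂ × ℂ => sinhNegSq (lam * q.2)) p :=
      (analyticAt_sinhNegSq_mul lam hp.2.2.2.2.1).comp_of_eq analyticAt_snd rfl
    have h4 : AnalyticAt ℂ (fun q : ℂ × ℂ => coshNegSq (lam * q.2)) p :=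
      (analyticAt_coshNegSq_mul lam hp.2.2.2.2.2).comp_of_eq analyticAt_snd rfl
    fun_prop
  · have h3 := hp.2.2.1
    have h4 := hp.2.2.2.1
    refine (((((hasDerivAt_sinhNegSq_mul lam h3).const_mul (C 0)).fun_add
      ((hasDerivAt_coshNegSq_mul lam h4).const_mul (C 1))).fun_add
      (((hasDerivAt_sinh_mul lam p.1).fun_pow 2).const_mul (C 2))).fun_add
      (((hasDerivAt_sinh_mul (2 * lam) p.1).fun_pow 2).const_mul (1 / 4 * C 3))).congr_deriv ?_
    simp only [sinh_two_mul_mul, cosh_two_mul_mul, add_comm (1 : ℂ), ← cosh_sq]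
    push_cast
    field_simp
    linear_combination
      4 * lam * C 3 * cosh (lam * p.1) ^ 4 * sinh (lam * p.1) ^ 4 * cosh_sq (lam * p.1)
  · obtain ⟨h1, h2, h3, h4, h5, h6⟩ := hp
    refine ((((((hasDerivAt_sinhNegSq_mul lam h3).const_mul (C 0)).mul_const _).fun_sub
      (((hasDerivAt_coshNegSq_mul lam h4).const_mul (C 1)).mul_const _)).fun_add
      ((((((hasDerivAt_sinh_mul lam p.1).fun_pow 2).add_const _).fun_add
        ((((hasDerivAt_sinh_mul lam p.1).fun_pow 2).const_mul 2).mul_const _)).const_mul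
          (C 3)))).const_mul A).congr_deriv ?_
    simp only [sinhNegSq, coshNegSq, add_comm (1 : ℂ) (sinh _ ^ 2), ← cosh_sq]
    push_cast
    field_simp
    ring
  · obtain ⟨h1, h2, h3, h4, h5, h6⟩ := hp
    have hX := pow_ne_zero 2 h3
    have hY := pow_ne_zero 2 h5
    have hX' := pow_ne_zero 2 h4
    have hY' := pow_ne_zero 2 h6
    have hcx := cosh_sq (lam * p.1)
    have hcy := cosh_sq (lam * p.2)
    simp only [mul_sub lam, mul_add lam, sinh_add, sinh_sub] at h1 h2
    simp only [trigB2, sinhNegSq, coshNegSq, mul_sub lam, mul_add lam, cosh_add, cosh_sub, sinh_add,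
      sinh_sub, sinh_two_mul_mul]
    generalize cosh (lam * p.1) = c at *
    generalize sinh (lam * p.1) = s at *
    generalize cosh (lam * p.2) = k at *
    generalize sinh (lam * p.2) = r at *
    -- The product `sinh λ(x - y) sinh λ(x + y)` equals `X - Y`, so the sums and differences of
    -- `u⁻`, `u⁺` and of their derivatives have powers of `X - Y` as denominators. In `e2` and `e3`
    -- an odd factor `s * c` splits off and the rest is rational in `X` and `Y`; `e2` needs the
    -- factor `r * k` supplied by `v'(y)`.
    have hD : s ^ 2 - r ^ 2 = (s * k - c * r) * (s * k + c * r) := by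
      linear_combination (-s ^ 2) * hcy + r ^ 2 * hcx
    have hXY : s ^ 2 - r ^ 2 ≠ 0 := hD ▸ mul_ne_zero h1 h2
    rw [hcx, add_comm] at hX'
    rw [hcy, add_comm] at hY'
    have e1 : 1 / (s * k - c * r) ^ 2 + 1 / (s * k + c * r) ^ 2 =
        2 * (s ^ 2 * (1 + r ^ 2) + (1 + s ^ 2) * r ^ 2) / (s ^ 2 - r ^ 2) ^ 2 := by
      rw [hD, mul_pow, add_comm 1, add_comm 1, ← hcx, ← hcy]
      field_simp
      ring
    have e2 : (1 / (s * k - c * r) ^ 2 - 1 / (s * k + c * r) ^ 2) * (r * k) =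
        4 * (s * c) * (r ^ 2 * (1 + r ^ 2)) / (s ^ 2 - r ^ 2) ^ 2 := by
      rw [hD, mul_pow, add_comm 1, ← hcy]
      field_simp
      ring
    have e3 : (c * k - s * r) / (s * k - c * r) ^ 3 + (c * k + s * r) / (s * k + c * r) ^ 3 =
        2 * (s * c) * ((1 + r ^ 2) * (s ^ 2 * (1 + r ^ 2) + 3 * (1 + s ^ 2) * r ^ 2) -
          r ^ 2 * (3 * s ^ 2 * (1 + r ^ 2) + (1 + s ^ 2) * r ^ 2)) / (s ^ 2 - r ^ 2) ^ 3 := by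
      rw [hD, mul_pow, add_comm 1, add_comm 1, ← hcx, ← hcy,
        div_add_div _ _ (pow_ne_zero 3 h1) (pow_ne_zero 3 h2)]
      congr 1
      ring
    have key := trigB2_rational_identity C hX hX' hY hY' hXY
    have v1 : C 0 * (1 / s ^ 2) + C 1 * (1 / c ^ 2) + C 2 * s ^ 2 + 1 / 4 * C 3 * (2 * s * c) ^ 2 =
        C 0 / s ^ 2 + C 1 / (1 + s ^ 2) + C 2 * s ^ 2 + C 3 * s ^ 2 * (1 + s ^ 2) := by
      rw [add_comm 1, ← hcx]
      ring
    have v2 : C 0 * (1 / r ^ 2) + C 1 * (1 / k ^ 2) + C 2 * r ^ 2 + 1 / 4 * C 3 * (2 * r * k) ^ 2 =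
        C 0 / r ^ 2 + C 1 / (1 + r ^ 2) + C 2 * r ^ 2 + C 3 * r ^ 2 * (1 + r ^ 2) := by
      rw [add_comm 1, ← hcy]
      ring
    rw [v1, v2]
    generalize C 0 / s ^ 2 + C 1 / (1 + s ^ 2) + C 2 * s ^ 2 + C 3 * s ^ 2 * (1 + s ^ 2) = V at *
    generalize C 0 / r ^ 2 + C 1 / (1 + r ^ 2) + C 2 * r ^ 2 + C 3 * r ^ 2 * (1 + r ^ 2) = W at *
    generalize -C 0 / (s ^ 2) ^ 2 - C 1 / (1 + s ^ 2) ^ 2 + C 2 + C 3 * (1 + 2 * s ^ 2) = V' at *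
    generalize -C 0 / (r ^ 2) ^ 2 - C 1 / (1 + r ^ 2) ^ 2 + C 2 + C 3 * (1 + 2 * r ^ 2) = W' at *
    linear_combination A * (2 * lam * (s * c)) * key + A * (-2 * lam) * (V - W) * e3 +
      A * (2 * lam * (s * c)) * V' * e1 + A * (2 * lam) * W' * e2
  · simp only [trigB2]
    ring

end Hyperbolic

/-! ### The elliptic family: an addition theorem for `℘` from Liouville's theorem. -/

section Elliptic

/-- The function `r` is the divided difference `dslope p c`, so the equation holds at every `z`, not
only near `c`. -/
lemma AnalyticAt.exists_eq_add_mul {p : ℂ → ℂ} {c : ℂ} (hp : AnalyticAt ℂ p c) :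
    ∃ r : ℂ → ℂ, AnalyticAt ℂ r c ∧ ∀ z, p z = p c + (z - c) * r z := by
  obtain ⟨s, hs⟩ := hp
  refine ⟨dslope p c, ⟨_, hs.has_fpower_series_dslope_fslope⟩, fun z => ?_⟩
  rw [← smul_eq_mul, sub_smul_dslope]
  ring

/-- Three terms suffice to cancel poles, since `℘'` has poles of order three. The expansion of `p`
and that of its derivative share the same remainder `r`, which makes the cancellations below
algebraic. -/
lemma AnalyticAt.exists_taylor_three {p : ℂ → ℂ} {c : ℂ} (hp : AnalyticAt ℂ p c) :
    ∃ (b : ℂ) (r : ℂ → ℂ), AnalyticAt ℂ r c ∧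
      (∀ z, p z = p c + (z - c) * deriv p c + (z - c) ^ 2 * b + (z - c) ^ 3 * r z) ∧
      ∀ᶠ z in 𝓝 c, deriv p z =
        deriv p c + 2 * (z - c) * b + 3 * (z - c) ^ 2 * r z + (z - c) ^ 3 * deriv r z := by
  obtain ⟨r₁, h₁, e₁⟩ := hp.exists_eq_add_mul
  obtain ⟨r₂, h₂, e₂⟩ := h₁.exists_eq_add_mul
  obtain ⟨r, h, e⟩ := h₂.exists_eq_add_mul
  have hz : ∀ z, p z = p c + (z - c) * r₁ c + (z - c) ^ 2 * r₂ c + (z - c) ^ 3 * r z := by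
    intro z
    rw [e₁ z, e₂ z, e z]
    ring
  have hd : ∀ᶠ z in 𝓝 c, deriv p z =
      r₁ c + 2 * (z - c) * r₂ c + 3 * (z - c) ^ 2 * r z + (z - c) ^ 3 * deriv r z := by
    filter_upwards [h.eventually_analyticAt] with z hr
    have h0 := (hasDerivAt_id' z).sub_const c
    have hd : HasDerivAt p (r₁ c + 2 * (z - c) * r₂ c + 3 * (z - c) ^ 2 * r z +
        (z - c) ^ 3 * deriv r z) z := by
      rw [funext hz]
      refine ((((h0.mul_const (r₁ c)).const_add (p c)).fun_add
        ((h0.fun_pow 2).mul_const (r₂ c))).fun_add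
        ((h0.fun_pow 3).fun_mul hr.differentiableAt.hasDerivAt)).congr_deriv ?_
      push_cast
      ring
    exact hd.deriv
  have hc : deriv p c = r₁ c := by simpa using hd.self_of_nhds
  rw [hc]
  exact ⟨r₂ c, r, h, hz, hd⟩

/-- `F` agrees on a punctured neighbourhood of `c` with a function that is analytic at `c`. -/
def HasAnalyticExtensionAt (F : ℂ → ℂ) (c : ℂ) : Prop :=
  ∃ g : ℂ → ℂ, AnalyticAt ℂ g c ∧ F =ᶠ[𝓝[≠] c] g

lemma HasAnalyticExtensionAt.comp_add {F : ℂ → ℂ} {c : ℂ} (l : ℂ)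
    (h : HasAnalyticExtensionAt F (c + l)) : HasAnalyticExtensionAt (fun z => F (z + l)) c := by
  obtain ⟨g, hg, hFg⟩ := h
  refine ⟨fun z => g (z + l), hg.comp_of_eq (f := fun z => z + l) (by fun_prop) rfl, ?_⟩
  have ht : Tendsto (fun z => z + l) (𝓝[≠] c) (𝓝[≠] (c + l)) :=
    tendsto_nhdsWithin_of_tendsto_nhds_of_eventually_within _
      (((continuous_id.add continuous_const).tendsto' c (c + l) rfl).mono_left nhdsWithin_le_nhds)
      (eventually_nhdsWithin_of_forall fun z hz => by simpa using hz)
  exact hFg.comp_tendsto ht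

lemma HasAnalyticExtensionAt.comp_neg {F : ℂ → ℂ} {c : ℂ}
    (h : HasAnalyticExtensionAt F (-c)) : HasAnalyticExtensionAt (fun z => -F (-z)) c := by
  obtain ⟨g, hg, hFg⟩ := h
  refine ⟨fun z => -g (-z), (hg.comp_of_eq (f := fun z => -z) (by fun_prop) rfl).neg, ?_⟩
  have ht : Tendsto (fun z : ℂ => -z) (𝓝[≠] c) (𝓝[≠] (-c)) :=
    tendsto_nhdsWithin_of_tendsto_nhds_of_eventually_within _
      ((continuous_neg.tendsto' c (-c) rfl).mono_left nhdsWithin_le_nhds)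
      (eventually_nhdsWithin_of_forall fun z hz => by simpa using hz)
  exact (hFg.comp_tendsto ht).neg

namespace PeriodPair

variable (L : PeriodPair)

/-- A lattice periodic function with only removable singularities is constant. -/
theorem exists_eq_const_of_hasAnalyticExtensionAt {F : ℂ → ℂ}
    (hper : ∀ z, ∀ l ∈ L.lattice, F (z + l) = F z) (hrem : ∀ c, HasAnalyticExtensionAt F c) :
    ∃ K, ∀ c, ContinuousAt F c → F c = K := by
  -- Punctured limits fill in the removable singularities and discard whatever values `F` has there.
  -- The resulting `G` is entire and periodic, hence bounded, and it agrees with `F` wherever `F` is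
  -- continuous.
  let G : ℂ → ℂ := fun c => limUnder (𝓝[≠] c) F
  have hG : ∀ c, ∀ g : ℂ → ℂ, ContinuousAt g c → F =ᶠ[𝓝[≠] c] g → G c = g c := fun c g hg hFg =>
    ((hg.tendsto.mono_left nhdsWithin_le_nhds).congr' hFg.symm).limUnder_eq
  have hGan : Differentiable ℂ G := by
    intro c
    obtain ⟨g, hg, hFg⟩ := hrem c
    refine (hg.congr ?_).differentiableAt
    filter_upwards [hg.eventually_analyticAt,
      eventually_nhdsWithin_iff.1 (eventually_eventually_nhdsWithin.2 hFg)] with z hz hz'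
    refine (hG z g hz.continuousAt ?_).symm
    rcases eq_or_ne z c with rfl | hzc
    · exact hFg
    · have h := hz' hzc
      rw [isOpen_compl_singleton.nhdsWithin_eq hzc] at h
      exact h.filter_mono nhdsWithin_le_nhds
  have hGper : ∀ z, ∀ l ∈ L.lattice, G (z + l) = G z := by
    intro z l hl
    obtain ⟨g, hg, hFg⟩ := hrem (z + l)
    rw [hG _ g hg.continuousAt hFg]
    have hg' : ContinuousAt (fun w => g (w + l)) z :=
      hg.continuousAt.comp_of_eq (f := fun w => w + l) (by fun_prop) rfl
    refine (hG z _ hg' ?_).symm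
    have ht : Tendsto (fun w => w + l) (𝓝[≠] z) (𝓝[≠] (z + l)) :=
      tendsto_nhdsWithin_of_tendsto_nhds_of_eventually_within _
        (((continuous_id.add continuous_const).tendsto' z (z + l) rfl).mono_left nhdsWithin_le_nhds)
        (eventually_nhdsWithin_of_forall fun w hw => by simpa using hw)
    filter_upwards [ht.eventually hFg] with w hw
    rw [← hw, hper w l hl]
  refine ⟨G 0, fun c hc => ?_⟩
  rw [← hG c F hc (EventuallyEq.refl _ _)]
  exact hGan.apply_eq_apply_of_bounded
    (IsZLattice.isCompact_range_of_periodic L.lattice G hGan.continuous hGper).isBounded c 0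

/-- Splits off the principal part at the origin; `L.weierstrassPExcept 0` is analytic there. -/
lemma weierstrassP_eq_add_div (z : ℂ) :
    L.weierstrassP z = L.weierstrassPExcept 0 z + 1 / z ^ 2 := by
  have h := L.weierstrassPExcept_add 0 z
  simpa using h.symm

lemma derivWeierstrassP_eq_sub_div (z : ℂ) :
    L.derivWeierstrassP z = L.derivWeierstrassPExcept 0 z - 2 / z ^ 3 := by
  have h := L.derivWeierstrassPExcept_sub 0 z
  simpa using h.symm

lemma hasDerivAt_weierstrassP {z : ℂ} (hz : z ∉ L.lattice) :
    HasDerivAt L.weierstrassP (L.derivWeierstrassP z) z := by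
  have h := (L.analyticOnNhd_weierstrassP z hz).differentiableAt.hasDerivAt
  rwa [L.deriv_weierstrassP] at h

/-- The function of `x` that vanishes by the addition theorem. -/
noncomputable def additionDefect (y x : ℂ) : ℂ :=
  (L.derivWeierstrassP (x - y) + L.derivWeierstrassP (x + y)) *
      (L.weierstrassP x - L.weierstrassP y) +
    (L.weierstrassP (x - y) + L.weierstrassP (x + y)) * L.derivWeierstrassP x +
    (L.weierstrassP (x - y) - L.weierstrassP (x + y)) * L.derivWeierstrassP y -
    2 * (L.derivWeierstrassP x * L.weierstrassP y)

lemma additionDefect_add_coe (y x l : ℂ) (hl : l ∈ L.lattice) :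
    L.additionDefect y (x + l) = L.additionDefect y x := by
  lift l to L.lattice using hl
  simp only [additionDefect, add_sub_right_comm x, add_right_comm x, L.weierstrassP_add_coe,
    L.derivWeierstrassP_add_coe]

lemma additionDefect_neg (y x : ℂ) : L.additionDefect y (-x) = -L.additionDefect y x := by
  have h1 : -x - y = -(x + y) := by ring
  have h2 : -x + y = -(x - y) := by ring
  simp only [additionDefect, h1, h2, L.weierstrassP_neg, L.derivWeierstrassP_neg]
  ring

variable {L} {x y : ℂ}

lemma analyticAt_weierstrassP (hx : x ∉ L.lattice) : AnalyticAt ℂ L.weierstrassP x :=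
  L.analyticOnNhd_weierstrassP x hx

lemma analyticAt_derivWeierstrassP (hx : x ∉ L.lattice) : AnalyticAt ℂ L.derivWeierstrassP x :=
  L.analyticOnNhd_derivWeierstrassP x hx

lemma analyticAt_weierstrassP_add (h : x + y ∉ L.lattice) :
    AnalyticAt ℂ (fun z => L.weierstrassP (z + y)) x :=
  (analyticAt_weierstrassP h).comp_of_eq (f := fun z => z + y) (by fun_prop) rfl

lemma analyticAt_derivWeierstrassP_add (h : x + y ∉ L.lattice) :
    AnalyticAt ℂ (fun z => L.derivWeierstrassP (z + y)) x :=
  (analyticAt_derivWeierstrassP h).comp_of_eq (f := fun z => z + y) (by fun_prop) rfl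

lemma analyticAt_weierstrassP_sub (h : x - y ∉ L.lattice) :
    AnalyticAt ℂ (fun z => L.weierstrassP (z - y)) x :=
  (analyticAt_weierstrassP h).comp_of_eq (f := fun z => z - y) (by fun_prop) rfl

lemma analyticAt_derivWeierstrassP_sub (h : x - y ∉ L.lattice) :
    AnalyticAt ℂ (fun z => L.derivWeierstrassP (z - y)) x :=
  (analyticAt_derivWeierstrassP h).comp_of_eq (f := fun z => z - y) (by fun_prop) rfl

lemma analyticAt_additionDefect (hx : x ∉ L.lattice) (hs : x - y ∉ L.lattice)
    (ha : x + y ∉ L.lattice) : AnalyticAt ℂ (L.additionDefect y) x := by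
  have h1 := analyticAt_weierstrassP hx
  have h2 := analyticAt_derivWeierstrassP hx
  have h3 := analyticAt_weierstrassP_add ha
  have h4 := analyticAt_derivWeierstrassP_add ha
  have h5 := analyticAt_weierstrassP_sub hs
  have h6 := analyticAt_derivWeierstrassP_sub hs
  unfold additionDefect
  fun_prop

/-- With `t = x - y`, the singular part is `-2/t³ (℘(x) - ℘(y)) + 1/t² (℘'(x) + ℘'(y))`. Inserting
the Taylor expansions at `y` cancels all negative powers and leaves `r + t r'`. The condition on `y
+ y` keeps the terms in `x + y` analytic at `x = y`. -/
lemma hasAnalyticExtensionAt_additionDefect_self (hy : y ∉ L.lattice) (h2y : y + y ∉ L.lattice) :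
    HasAnalyticExtensionAt (L.additionDefect y) y := by
  obtain ⟨b, r, hr, hp, hdp⟩ := (analyticAt_weierstrassP hy).exists_taylor_three
  rw [L.deriv_weierstrassP] at hp hdp
  have h1 := analyticAt_weierstrassP hy
  have h2 := analyticAt_derivWeierstrassP hy
  have h3 := analyticAt_weierstrassP_add h2y
  have h4 := analyticAt_derivWeierstrassP_add h2y
  have h5 : AnalyticAt ℂ (fun z => L.weierstrassPExcept 0 (z - y)) y :=
    (L.analyticAt_weierstrassPExcept 0).comp_of_eq (f := fun z => z - y) (by fun_prop) (sub_self y)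
  have h6 : AnalyticAt ℂ (fun z => L.derivWeierstrassPExcept 0 (z - y)) y :=
    (L.analyticAt_derivWeierstrassPExcept 0).comp_of_eq (f := fun z => z - y) (by fun_prop)
      (sub_self y)
  have hdr := hr.deriv
  refine ⟨fun x => (L.derivWeierstrassPExcept 0 (x - y) + L.derivWeierstrassP (x + y)) *
      (L.weierstrassP x - L.weierstrassP y) +
    (L.weierstrassPExcept 0 (x - y) + L.weierstrassP (x + y)) * L.derivWeierstrassP x +
    (L.weierstrassPExcept 0 (x - y) - L.weierstrassP (x + y)) * L.derivWeierstrassP y -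
    2 * (L.derivWeierstrassP x * L.weierstrassP y) + (r x + (x - y) * deriv r x),
    by fun_prop, ?_⟩
  filter_upwards [self_mem_nhdsWithin, nhdsWithin_le_nhds hdp] with x hx hdx
  have ht : x - y ≠ 0 := sub_ne_zero.2 hx
  have key : -2 / (x - y) ^ 3 * (L.weierstrassP x - L.weierstrassP y) +
      1 / (x - y) ^ 2 * (L.derivWeierstrassP x + L.derivWeierstrassP y) =
      r x + (x - y) * deriv r x := by
    rw [hdx, hp x]
    field_simp
    ring
  rw [← key, additionDefect, L.weierstrassP_eq_add_div (x - y),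
    L.derivWeierstrassP_eq_sub_div (x - y)]
  ring

/-- Put `S(x) = ℘(x - y) + ℘(x + y)`. The singular part is `S'(x)/x² - 2/x³ (S(x) - 2 ℘(y))`. As `S`
is even with `S(0) = 2 ℘(y)`, its expansion has no linear term and the negative powers cancel. -/
lemma hasAnalyticExtensionAt_additionDefect_zero (hy : y ∉ L.lattice) :
    HasAnalyticExtensionAt (L.additionDefect y) 0 := by
  have hy1 : 0 + y ∉ L.lattice := by rwa [zero_add]
  have hy2 : 0 - y ∉ L.lattice := by rwa [zero_sub, neg_mem_iff]
  have h1 := L.analyticAt_weierstrassPExcept 0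
  have h2 := L.analyticAt_derivWeierstrassPExcept 0
  have h3 := analyticAt_weierstrassP_add hy1
  have h4 := analyticAt_derivWeierstrassP_add hy1
  have h5 := analyticAt_weierstrassP_sub hy2
  have h6 := analyticAt_derivWeierstrassP_sub hy2
  obtain ⟨b, r, hr, hp, hdp⟩ := (h5.fun_add h3).exists_taylor_three
  have hd : ∀ᶠ x in 𝓝 (0 : ℂ), deriv (fun z => L.weierstrassP (z - y) + L.weierstrassP (z + y)) x =
      L.derivWeierstrassP (x - y) + L.derivWeierstrassP (x + y) := by
    filter_upwards [h3.eventually_analyticAt, h5.eventually_analyticAt] with x hx hx'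
    rw [deriv_fun_add hx'.differentiableAt hx.differentiableAt, deriv_comp_sub_const,
      deriv_comp_add_const, L.deriv_weierstrassP]
  have hd0 : deriv (fun z => L.weierstrassP (z - y) + L.weierstrassP (z + y)) 0 = 0 := by
    rw [hd.self_of_nhds, zero_sub, zero_add, L.derivWeierstrassP_neg]
    ring
  simp only [hd0, zero_sub, zero_add, L.weierstrassP_neg, sub_zero, mul_zero, add_zero] at hp hdp
  have hdr := hr.deriv
  refine ⟨fun x => (L.derivWeierstrassP (x - y) + L.derivWeierstrassP (x + y)) *
      (L.weierstrassPExcept 0 x - L.weierstrassP y) +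
    (L.weierstrassP (x - y) + L.weierstrassP (x + y)) * L.derivWeierstrassPExcept 0 x +
    (L.weierstrassP (x - y) - L.weierstrassP (x + y)) * L.derivWeierstrassP y -
    2 * (L.derivWeierstrassPExcept 0 x * L.weierstrassP y) + (r x + x * deriv r x),
    by fun_prop, ?_⟩
  filter_upwards [self_mem_nhdsWithin, nhdsWithin_le_nhds hdp, nhdsWithin_le_nhds hd]
    with x hx hdx hdx'
  have ht : x ≠ 0 := hx
  have key : (L.derivWeierstrassP (x - y) + L.derivWeierstrassP (x + y)) / x ^ 2 -
      2 / x ^ 3 * (L.weierstrassP (x - y) + L.weierstrassP (x + y) - 2 * L.weierstrassP y) =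
      r x + x * deriv r x := by
    rw [← hdx', hdx, hp x]
    field_simp
    ring
  rw [← key, additionDefect, L.weierstrassP_eq_add_div x, L.derivWeierstrassP_eq_sub_div x]
  ring

/-- Modulo the lattice only `0`, `y` and `-y` can be singular, and there the singularities are
removable; the point `-y` reduces to `y` by oddness. So the defect takes one constant value at its
points of continuity, in particular at `x` and `-x`, and oddness forces this value to be zero. -/
theorem additionDefect_eq_zero (hx : x ∉ L.lattice) (hy : y ∉ L.lattice) (h2y : y + y ∉ L.lattice)
    (hs : x - y ∉ L.lattice) (ha : x + y ∉ L.lattice) : L.additionDefect y x = 0 := by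
  have hper := L.additionDefect_add_coe y
  have hodd : (fun z => -L.additionDefect y (-z)) = L.additionDefect y := by
    ext z
    rw [L.additionDefect_neg, neg_neg]
  have hshift : ∀ c d, c - d ∈ L.lattice → HasAnalyticExtensionAt (L.additionDefect y) d →
      HasAnalyticExtensionAt (L.additionDefect y) c := by
    intro c d hcd h
    have h' := HasAnalyticExtensionAt.comp_add (c := c) (d - c) (by simpa using h)
    rwa [funext fun z => hper z (d - c) (by rwa [← neg_sub, neg_mem_iff])] at h'
  have hrem : ∀ c, HasAnalyticExtensionAt (L.additionDefect y) c := by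
    intro c
    by_cases h0 : c ∈ L.lattice
    · exact hshift c 0 (by rwa [sub_zero]) (hasAnalyticExtensionAt_additionDefect_zero hy)
    by_cases h1 : c - y ∈ L.lattice
    · exact hshift c y h1 (hasAnalyticExtensionAt_additionDefect_self hy h2y)
    by_cases h2 : c + y ∈ L.lattice
    · refine hshift c (-y) (by rwa [sub_neg_eq_add]) ?_
      rw [← hodd]
      refine HasAnalyticExtensionAt.comp_neg ?_
      rw [neg_neg]
      exact hasAnalyticExtensionAt_additionDefect_self hy h2y
    · exact ⟨_, analyticAt_additionDefect h0 h1 h2, EventuallyEq.refl _ _⟩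
  obtain ⟨K, hK⟩ := L.exists_eq_const_of_hasAnalyticExtensionAt hper hrem
  have e1 := hK x (analyticAt_additionDefect hx hs ha).continuousAt
  have e2 := hK (-x) (analyticAt_additionDefect (by rwa [neg_mem_iff])
    (by rwa [← neg_add', neg_mem_iff]) (by rwa [neg_add_eq_sub, ← neg_sub, neg_mem_iff])).continuousAt
  rw [L.additionDefect_neg, e1] at e2
  rw [e1]
  exact self_eq_neg.1 e2.symm

lemma halfPeriod_add_self_mem (j : Fin 4) : halfPeriod L j + halfPeriod L j ∈ L.lattice := by
  rw [mem_lattice]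
  fin_cases j
  · exact ⟨0, 0, by simp [halfPeriod]⟩
  · exact ⟨1, 0, by simp [halfPeriod]⟩
  · exact ⟨0, 1, by simp [halfPeriod]⟩
  · exact ⟨-1, -1, by simp [halfPeriod]; ring⟩

/-- If `2y = m (2ω₁) + n (2ω₂)`, the parities of `m` and `n` select the half period `ω_j` for which
`y + ω_j` is a lattice point. -/
lemma add_self_notMem_lattice (h : ∀ j, y + halfPeriod L j ∉ L.lattice) : y + y ∉ L.lattice := by
  intro hy
  obtain ⟨m, n, hmn⟩ := mem_lattice.1 hy
  rcases Int.even_or_odd' m with ⟨a, rfl | rfl⟩ <;> rcases Int.even_or_odd' n with ⟨b, rfl | rfl⟩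
  · refine h 0 (mem_lattice.2 ⟨a, b, ?_⟩)
    simp only [halfPeriod, Matrix.cons_val]
    push_cast at hmn
    linear_combination hmn / 2
  · refine h 2 (mem_lattice.2 ⟨a, b + 1, ?_⟩)
    simp only [halfPeriod, Matrix.cons_val]
    push_cast at hmn ⊢
    linear_combination hmn / 2
  · refine h 1 (mem_lattice.2 ⟨a + 1, b, ?_⟩)
    simp only [halfPeriod, Matrix.cons_val]
    push_cast at hmn ⊢
    linear_combination hmn / 2
  · refine h 3 (mem_lattice.2 ⟨a, b, ?_⟩)
    simp only [halfPeriod, Matrix.cons_val]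
    push_cast at hmn ⊢
    linear_combination hmn / 2

end PeriodPair

open PeriodPair

theorem ellipB2_isCommuting (L : PeriodPair) (A : ℂ) (C : Fin 4 → ℂ) :
    (ellipB2 L A C).IsCommuting := by
  refine IsCompatible.isCommuting _ (IsCompatible.of_symm_of_eq
    (dum := fun t => A * L.derivWeierstrassP t) (dup := fun t => A * L.derivWeierstrassP t)
    (dv := fun t => ∑ j, C j * L.derivWeierstrassP (t + halfPeriod L j))
    (τ := fun x y => A * ∑ j, C j * L.weierstrassP (x + halfPeriod L j) *
      L.weierstrassP (y + halfPeriod L j))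
    (dτ := fun x y => A * ∑ j, C j * L.derivWeierstrassP (x + halfPeriod L j) *
      L.weierstrassP (y + halfPeriod L j))
    (fun p hp => ?_) (fun t => ?_) (fun x y => ?_) (fun x y => ?_)
    (fun p hp => analyticAt_const.mul (analyticAt_weierstrassP hp.1))
    (fun p hp => analyticAt_const.mul (analyticAt_weierstrassP hp.2.1))
    (fun p hp => ?_) (fun p hp => ?_)
    (fun p hp => (L.hasDerivAt_weierstrassP hp.1).const_mul A)
    (fun p hp => (L.hasDerivAt_weierstrassP hp.2.1).const_mul A)
    (fun p hp => ?_) (fun p hp => ?_) (fun p hp => ?_)) fun p _ => ?_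
  · obtain ⟨h1, h2, h3⟩ := hp
    refine ⟨?_, by rwa [Prod.fst_swap, Prod.snd_swap, add_comm], fun j => (h3 j).symm⟩
    rwa [Prod.fst_swap, Prod.snd_swap, ← neg_sub, neg_mem_iff]
  · simp [ellipB2, L.weierstrassP_neg]
  · simp only [ellipB2, mul_add, Finset.sum_add_distrib]
    ring
  · exact congrArg _ (Finset.sum_congr rfl fun j _ => by ring)
  · have h := fun j => analyticAt_weierstrassP_add (hp.2.2 j).1
    exact Finset.analyticAt_fun_sum Finset.univ fun j _ => analyticAt_const.mul (h j)
  · refine analyticAt_const.mul (Finset.analyticAt_fun_sum _ fun j _ => ?_)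
    exact (analyticAt_const.mul ((analyticAt_weierstrassP_add (hp.2.2 j).1).comp_of_eq
      analyticAt_fst rfl)).mul ((analyticAt_weierstrassP_add (hp.2.2 j).2).comp_of_eq
      analyticAt_snd rfl)
  · exact HasDerivAt.fun_sum (u := Finset.univ) fun j _ =>
      ((L.hasDerivAt_weierstrassP (hp.2.2 j).1).comp_add_const _ _).const_mul (C j)
  · exact (HasDerivAt.fun_sum fun j _ =>
      (((L.hasDerivAt_weierstrassP (hp.2.2 j).1).comp_add_const _ _).const_mul
        (C j)).mul_const _).const_mul A
  · obtain ⟨h1, h2, h3⟩ := hp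
    have h2y : ∀ j, p.2 + halfPeriod L j + (p.2 + halfPeriod L j) ∉ L.lattice := by
      intro j
      rw [add_add_add_comm, Submodule.add_mem_iff_left _ (halfPeriod_add_self_mem j)]
      exact add_self_notMem_lattice fun j => (h3 j).2
    -- The addition theorem is used at `(x + ω_j, y + ω_j)`: the difference is still `x - y`, and
    -- the sum is `x + y + 2ω_j`, where `2ω_j` is a period. Summing with weights `A * C j` gives the
    -- required equation.
    have key : ∀ j, L.additionDefect (p.2 + halfPeriod L j) (p.1 + halfPeriod L j) = 0 := by
      intro j
      refine additionDefect_eq_zero (h3 j).1 (h3 j).2 (h2y j) (by rwa [add_sub_add_right_eq_sub]) ?_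
      rwa [add_add_add_comm, Submodule.add_mem_iff_left _ (halfPeriod_add_self_mem j)]
    have hp : ∀ j, L.weierstrassP (p.1 + p.2 + (halfPeriod L j + halfPeriod L j)) =
      L.weierstrassP (p.1 + p.2) := fun j => L.weierstrassP_add_coe _ ⟨_, halfPeriod_add_self_mem j⟩
    have hp' : ∀ j, L.derivWeierstrassP (p.1 + p.2 + (halfPeriod L j + halfPeriod L j)) =
      L.derivWeierstrassP (p.1 + p.2) :=
      fun j => L.derivWeierstrassP_add_coe _ ⟨_, halfPeriod_add_self_mem j⟩
    simp only [additionDefect, add_sub_add_right_eq_sub, add_add_add_comm p.1, hp, hp'] at key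
    simp only [ellipB2, Finset.mul_sum, ← Finset.sum_sub_distrib, ← Finset.sum_add_distrib]
    refine Finset.sum_congr rfl fun j _ => ?_
    linear_combination A * C j * key j
  · simp only [ellipB2, mul_add, Finset.sum_add_distrib]
    ring

end Elliptic

theorem mainTheorem6 (L : PeriodPair) (lam A : ℂ) (C : Fin 4 → ℂ) :
    (ellipB2 L A C).IsCommuting ∧
    (trigB2 lam A C).IsCommuting ∧
    (ratB2 A C).IsCommuting ∧
    (ratB2Alt A C).IsCommuting ∧
    (∀ p ∈ (ratB2 A C).domain,
      (ratB2 A C).T p.1 p.2 = (ratB2Alt A C).T p.1 p.2 + 4 * A * C 1) ∧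
    (todaD2Bry lam A C).IsCommuting ∧
    (todaB2Bry lam A C).IsCommuting ∧
    (trigA1Bry lam A C).IsCommuting ∧
    (todaC2 lam A C).IsCommuting ∧
    (ratA1Bry A C).IsCommuting :=
  ⟨ellipB2_isCommuting L A C, trigB2_isCommuting lam A C, ratB2_isCommuting A C,
    ratB2Alt_isCommuting A C, ratB2_T_eq A C, todaD2Bry_isCommuting lam A C,
    todaB2Bry_isCommuting lam A C, trigA1Bry_isCommuting lam A C, todaC2_isCommuting lam A C,
    ratA1Bry_isCommuting A C⟩
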